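/- Let $K,P,q\ge 1$ be integers and let $\ell_1,\dots,\ell_P,m_1,\dots,m_P$ be non-negative integers with $\ell_p\le m_p$ for all $p$. Put $L=\ell_1+\dots+\ell_P$. Consider a system $A=A_1\otimes\dots\otimes A_P$ in which the block $A_p=(\mathbb{C}^q)^{\otimes m_p}$ consists of $m_p$ qudits of local dimension $q$, and consider $K$ copies of it, with Hilbert space $A^{\otimes K}$. For a system $S$ let $$\mathcal{T}_S(X)=\int_{\mathcal U(S)} U^{\otimes K}\,X\,(U^{\otimes K})^\dagger\,dU$$ be the $K$-fold twirl, where $dU$ is the Haar probability measure on the unitary group $\mathcal U(S)$; if $S$ is a subsystem of $A$, then $U\in\mathcal U(S)$ acts on $A$ as $U$ on $S$ and as the identity on the other qudits. On the linear operators on $A^{\otimes K}$ define $$\mathcal P=\bigotimes_{p=1}^P\mathcal T_{A_p},\qquad \mathcal Q=\mathcal T_{A_1^{\ell_1}\cdots A_P^{\ell_P}},\qquad \mathcal R=\mathcal T_{A_1\cdots A_P},$$ where $A_p^{\ell_p}$ consists of the first $\ell_p$ qudits of the block $A_p$. Thus $\mathcal P$ is the twirl by independent Haar random unitaries on the $P$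 blocks, $\mathcal Q$ (the crosstwirl) is the twirl by one Haar random unitary acting jointly on the first $\ell_p$ qudits of all the blocks, and $\mathcal R$ is the full twirl. Assume that $K\le q^{m_p}$ for all $p$, that $K\le q^L$ and $K^2<2q^L$, that $$K^2\sum_{p=1}^P q^{-\ell_p}\le 1,$$ and that $m_p\ge 3\ell_p$ for all $p$. Then $$\|\mathcal P\mathcal Q-\mathcal R\|_{2\to2}\;\le\; 5K\sqrt{\sum_{p=1}^P\frac{1}{q^{2\ell_p}}},$$ where $\mathcal P\mathcal Q=\mathcal P\circ\mathcal Q$, $\|\Phi\|_{2\to2}=\sup_{X\ne0}\|\Phi(X)\|_2/\|X\|_2$ and $\|X\|_2=\operatorname{tr}(X^\dagger X)^{1/2}$. In other words, $\mathcal P\mathcal Q$ is a $K$-fold tensor product expander whose error is at most the right-hand side. -/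

import Mathlib

open scoped BigOperators Matrix

noncomputable section

namespace Twirl

/-- The unitary group `U(n)`, as a subspace of the space of matrices, is compact. -/
instance instCompactSpaceUnitary (κ : Type) [Fintype κ] [DecidableEq κ] :
    CompactSpace (Matrix.unitaryGroup κ ℂ) := by
  have hcl : IsClosed ((Matrix.unitaryGroup κ ℂ : Submonoid (Matrix κ κ ℂ)) :
      Set (Matrix κ κ ℂ)) := by
    have : ((Matrix.unitaryGroup κ ℂ : Submonoid (Matrix κ κ ℂ)) : Set (Matrix κ κ ℂ))
        = {A | A * star A = 1} := by
      ext A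
      exact Matrix.mem_unitaryGroup_iff
    rw [this]
    exact isClosed_eq (continuous_id.mul continuous_star) continuous_const
  have hc : IsCompact (Set.univ.pi fun _ : κ => Set.univ.pi fun _ : κ =>
      Metric.closedBall (0 : ℂ) 1) :=
    isCompact_univ_pi fun _ => isCompact_univ_pi fun _ => isCompact_closedBall _ _
  refine isCompact_iff_compactSpace.mp (hc.of_isClosed_subset hcl ?_)
  intro A hA i _ j _
  simpa using entry_norm_bound_of_unitary hA i j

instance instMeasurableSpaceUnitary (κ : Type) [Fintype κ] [DecidableEq κ] :
    MeasurableSpace (Matrix.unitaryGroup κ ℂ) := borel _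

instance instBorelSpaceUnitary (κ : Type) [Fintype κ] [DecidableEq κ] :
    BorelSpace (Matrix.unitaryGroup κ ℂ) := ⟨rfl⟩

/-- The Haar probability measure on the unitary group with index type `κ`. -/
def haarUnitary (κ : Type) [Fintype κ] [DecidableEq κ] :
    MeasureTheory.Measure (Matrix.unitaryGroup κ ℂ) :=
  MeasureTheory.Measure.haarMeasure ⊤

instance instIsProbabilityMeasureHaarUnitary (κ : Type) [Fintype κ] [DecidableEq κ] :
    MeasureTheory.IsProbabilityMeasure (haarUnitary κ) :=
  ⟨by simpa [haarUnitary] using MeasureTheory.Measure.haarMeasure_self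
        (K₀ := (⊤ : TopologicalSpace.PositiveCompacts (Matrix.unitaryGroup κ ℂ)))⟩

/-- The tensor power `V ⊗ ⋯ ⊗ V` (`K` factors), in the product basis. -/
def tensorPower {ι : Type} (K : ℕ) (V : Matrix ι ι ℂ) :
    Matrix (Fin K → ι) (Fin K → ι) ℂ :=
  Matrix.of fun i j => ∏ k, V (i k) (j k)

theorem continuous_tensorPower_conj {κ ι : Type} [Fintype κ] [DecidableEq κ] [Fintype ι]
    (K : ℕ) (V : C(Matrix.unitaryGroup κ ℂ, Matrix ι ι ℂ))
    (X : Matrix (Fin K → ι) (Fin K → ι) ℂ) :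
    Continuous fun U => tensorPower K (V U) * X * (tensorPower K (V U))ᴴ := by
  have h : Continuous fun U => tensorPower K (V U) := by
    refine continuous_matrix fun i j => ?_
    simp only [tensorPower, Matrix.of_apply]
    exact continuous_finsetProd _ fun k _ => V.continuous.matrix_elem (i k) (j k)
  exact (h.matrix_mul continuous_const).matrix_mul h.matrix_conjTranspose

/-- The Haar average `X ↦ ∫ V(U)^{⊗K} X (V(U)^{⊗K})† dU` over the unitary group `U(κ)`, where each
unitary `U` acts on one copy of the system (with index type `ι`) through the matrix `V(U)`.
The integral of a matrix is taken entry by entry. -/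
def haarAverage {κ ι : Type} [Fintype κ] [DecidableEq κ] [Fintype ι] [DecidableEq ι]
    (K : ℕ) (V : C(Matrix.unitaryGroup κ ℂ, Matrix ι ι ℂ)) :
    Matrix (Fin K → ι) (Fin K → ι) ℂ →ₗ[ℂ] Matrix (Fin K → ι) (Fin K → ι) ℂ where
  toFun X := Matrix.of fun i j =>
    ∫ U, (tensorPower K (V U) * X * (tensorPower K (V U))ᴴ) i j ∂(haarUnitary κ)
  map_add' X Y := by
    ext i j
    have hi : ∀ Z : Matrix (Fin K → ι) (Fin K → ι) ℂ, MeasureTheory.Integrable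
        (fun U => (tensorPower K (V U) * Z * (tensorPower K (V U))ᴴ) i j) (haarUnitary κ) :=
      fun Z => ((continuous_tensorPower_conj K V Z).matrix_elem i j).integrable_of_hasCompactSupport
        (HasCompactSupport.of_compactSpace _)
    simp only [Matrix.of_apply, Matrix.add_apply, mul_add, add_mul]
    exact MeasureTheory.integral_add (hi X) (hi Y)
  map_smul' c X := by
    ext i j
    simp only [Matrix.of_apply, Matrix.smul_apply, Matrix.mul_smul, Matrix.smul_mul,
      smul_eq_mul, RingHom.id_apply]
    exact MeasureTheory.integral_const_mul c _

/-- The `K`-fold twirl `X ↦ ∫ U^{⊗K} X (U^{⊗K})† dU` over the full unitary group of a system. -/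
def twirl (K : ℕ) (ι : Type) [Fintype ι] [DecidableEq ι] :
    Matrix (Fin K → ι) (Fin K → ι) ℂ →ₗ[ℂ] Matrix (Fin K → ι) (Fin K → ι) ℂ :=
  haarAverage K (κ := ι) (ι := ι) ⟨fun U => (U : Matrix ι ι ℂ), continuous_subtype_val⟩

/-- The tensor product of linear maps `T p` on operators on `K` copies of the systems `ι p`, as a
linear map on operators on `K` copies of the joint system `∏ p, ι p`; it is given by its values on
tensor products of matrix units (see `tensorMap_apply_tensor`). -/
def tensorMap {P K : ℕ} {ι : Fin P → Type} [∀ p, Fintype (ι p)] [∀ p, DecidableEq (ι p)]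
    (T : ∀ p, Matrix (Fin K → ι p) (Fin K → ι p) ℂ →ₗ[ℂ] Matrix (Fin K → ι p) (Fin K → ι p) ℂ) :
    Matrix (Fin K → ∀ p, ι p) (Fin K → ∀ p, ι p) ℂ →ₗ[ℂ]
      Matrix (Fin K → ∀ p, ι p) (Fin K → ∀ p, ι p) ℂ where
  toFun X := Matrix.of fun i j => ∑ a, ∑ b,
    (∏ p, T p (Matrix.single (fun k => a k p) (fun k => b k p) 1)
      (fun k => i k p) (fun k => j k p)) * X a b
  map_add' X Y := by
    ext i j
    simp [mul_add, Finset.sum_add_distrib]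
  map_smul' c X := by
    ext i j
    simp [Finset.mul_sum, mul_left_comm]

/-- On tensor product operators, `tensorMap T` is `X₁ ⊗ ⋯ ⊗ X_P ↦ T₁ X₁ ⊗ ⋯ ⊗ T_P X_P`. -/
theorem tensorMap_apply_tensor {P K : ℕ} {ι : Fin P → Type} [∀ p, Fintype (ι p)]
    [∀ p, DecidableEq (ι p)]
    (T : ∀ p, Matrix (Fin K → ι p) (Fin K → ι p) ℂ →ₗ[ℂ] Matrix (Fin K → ι p) (Fin K → ι p) ℂ)
    (X : ∀ p, Matrix (Fin K → ι p) (Fin K → ι p) ℂ) :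
    tensorMap T (Matrix.of fun i j => ∏ p, X p (fun k => i k p) (fun k => j k p)) =
      Matrix.of fun i j => ∏ p, T p (X p) (fun k => i k p) (fun k => j k p) := by
  ext i j
  have h1 : ∀ p, T p (X p) (fun k => i k p) (fun k => j k p) =
      ∑ ab : (Fin K → ι p) × (Fin K → ι p),
        T p (Matrix.single ab.1 ab.2 1) (fun k => i k p) (fun k => j k p) * X p ab.1 ab.2 := by
    intro p
    conv_lhs => rw [Matrix.matrix_eq_sum_single (X p)]
    rw [Fintype.sum_prod_type]
    simp only [map_sum, Matrix.sum_apply]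
    refine Finset.sum_congr rfl fun a _ => Finset.sum_congr rfl fun b _ => ?_
    have : Matrix.single a b (X p a b) = X p a b • Matrix.single a b (1 : ℂ) := by simp
    rw [this, map_smul, Matrix.smul_apply, smul_eq_mul, mul_comm]
  simp only [tensorMap, LinearMap.coe_mk, AddHom.coe_mk, Matrix.of_apply, h1]
  rw [Finset.prod_univ_sum, Fintype.piFinset_univ]
  refine (Fintype.sum_prod_type' _).symm.trans ?_
  let e : ((Fin K → ∀ p, ι p) × (Fin K → ∀ p, ι p)) ≃
      (∀ p, (Fin K → ι p) × (Fin K → ι p)) :=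
    { toFun := fun ab p => (fun k => ab.1 k p, fun k => ab.2 k p)
      invFun := fun f => (fun k p => (f p).1 k, fun k p => (f p).2 k)
      left_inv := fun _ => rfl
      right_inv := fun _ => rfl }
  refine Fintype.sum_equiv e _ _ fun ab => ?_
  rw [← Finset.prod_mul_distrib]
  rfl

/-- The basis of one copy of a block of `n` qudits of local dimension `q`. -/
abbrev Block (q n : ℕ) : Type := Fin n → Fin q

/-- The basis of one copy of the joint system of `P` blocks, the `p`-th having `m p` qudits. -/
abbrev Blocks (q : ℕ) {P : ℕ} (m : Fin P → ℕ) : Type := ∀ p : Fin P, Block q (m p)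

/-- The action `U ⊗ 1` on one copy of the joint system of a matrix `U` acting on the first `ℓ p`
qudits of each block `p`: `U` on those qudits, the identity on all the others. -/
def onFirstQudits {q P : ℕ} {ℓ m : Fin P → ℕ} (h : ∀ p, ℓ p ≤ m p)
    (U : Matrix (Blocks q ℓ) (Blocks q ℓ) ℂ) : Matrix (Blocks q m) (Blocks q m) ℂ :=
  Matrix.of fun i j =>
    U (fun p s => i p (Fin.castLE (h p) s)) (fun p s => j p (Fin.castLE (h p) s)) *
      if ∀ p, ∀ s : Fin (m p), ℓ p ≤ (s : ℕ) → i p s = j p s then 1 else 0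

/-- The twirl `𝒫 = ⨂ p, 𝒯_{A_p}` by independent Haar random unitaries on the `P` blocks. -/
def blockTwirl (K q : ℕ) {P : ℕ} (m : Fin P → ℕ) :
    Matrix (Fin K → Blocks q m) (Fin K → Blocks q m) ℂ →ₗ[ℂ]
      Matrix (Fin K → Blocks q m) (Fin K → Blocks q m) ℂ :=
  tensorMap fun p => twirl K (Block q (m p))

/-- The crosstwirl `𝒬`: the twirl by a joint Haar random unitary on the first `ℓ p` qudits of all
blocks `p`. -/
def crosstwirl (K q : ℕ) {P : ℕ} {ℓ m : Fin P → ℕ} (h : ∀ p, ℓ p ≤ m p) :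
    Matrix (Fin K → Blocks q m) (Fin K → Blocks q m) ℂ →ₗ[ℂ]
      Matrix (Fin K → Blocks q m) (Fin K → Blocks q m) ℂ :=
  haarAverage K (κ := Blocks q ℓ) (ι := Blocks q m)
    ⟨fun U => onFirstQudits h (U : Matrix (Blocks q ℓ) (Blocks q ℓ) ℂ),
      continuous_matrix fun _ _ =>
        (continuous_subtype_val.matrix_elem _ _).mul continuous_const⟩

/-- The full twirl `ℛ = 𝒯_{A_1 ⋯ A_P}` on the joint system. -/
def fullTwirl (K q : ℕ) {P : ℕ} (m : Fin P → ℕ) :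
    Matrix (Fin K → Blocks q m) (Fin K → Blocks q m) ℂ →ₗ[ℂ]
      Matrix (Fin K → Blocks q m) (Fin K → Blocks q m) ℂ :=
  twirl K (Blocks q m)

section Norm

attribute [local instance] Matrix.frobeniusNormedAddCommGroup Matrix.frobeniusNormedSpace

/-- The Schatten 2-norm `tr(X† X)^{1/2}` of a matrix, that is, its Frobenius norm. -/
def schatten2 {J : Type} [Fintype J] (X : Matrix J J ℂ) : ℝ := ‖X‖

/-- The norm `‖Φ‖_{2→2} = sup_{X ≠ 0} ‖Φ(X)‖₂ / ‖X‖₂` of a linear map on matrices. -/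
def norm22 {J : Type} [Fintype J] (Φ : Matrix J J ℂ →ₗ[ℂ] Matrix J J ℂ) : ℝ :=
  ⨆ X : {X : Matrix J J ℂ // X ≠ 0}, schatten2 (Φ X) / schatten2 (X : Matrix J J ℂ)

/-- The Schatten 2-norm is the square root of `tr(X† X)`. -/
theorem schatten2_eq {J : Type} [Fintype J] (X : Matrix J J ℂ) :
    schatten2 X = Real.sqrt (Xᴴ * X).trace.re := by
  have h : (Xᴴ * X).trace.re = ∑ i, ∑ j, ‖X i j‖ ^ 2 := by
    simp only [Matrix.trace, Matrix.diag, Matrix.mul_apply, Matrix.conjTranspose_apply,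
      Complex.re_sum]
    rw [Finset.sum_comm]
    refine Finset.sum_congr rfl fun i _ => Finset.sum_congr rfl fun j _ => ?_
    rw [Complex.star_def, ← Complex.normSq_eq_conj_mul_self, Complex.ofReal_re,
      Complex.normSq_eq_norm_sq]
  rw [h, schatten2, Matrix.frobenius_norm_def, Real.sqrt_eq_rpow]
  simp

/-- The supremum in the definition of `norm22` is over a bounded set, so that it is the true
supremum: `‖Φ(X)‖₂ ≤ ‖Φ‖_{2→2} ‖X‖₂` for all `X`. -/
theorem schatten2_le_norm22_mul {J : Type} [Fintype J]
    (Φ : Matrix J J ℂ →ₗ[ℂ] Matrix J J ℂ) (X : Matrix J J ℂ) :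
    schatten2 (Φ X) ≤ norm22 Φ * schatten2 X := by
  classical
  have hb : ∀ Y : Matrix J J ℂ,
      schatten2 (Φ Y) ≤ (∑ a, ∑ b, schatten2 (Φ (Matrix.single a b 1))) * schatten2 Y := by
    intro Y
    have hentry : ∀ a b, ‖Y a b‖ ≤ ‖Y‖ := by
      intro a b
      have h0 : ‖Y a b‖ ^ 2 ≤ ∑ i, ∑ j, ‖Y i j‖ ^ 2 :=
        (Finset.single_le_sum (f := fun j => ‖Y a j‖ ^ 2) (fun _ _ => by positivity)
          (Finset.mem_univ b)).trans
        (Finset.single_le_sum (f := fun i => ∑ j, ‖Y i j‖ ^ 2) (fun _ _ => by positivity)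
          (Finset.mem_univ a))
      have h1 : ‖Y‖ = Real.sqrt (∑ i, ∑ j, ‖Y i j‖ ^ 2) := by
        rw [Matrix.frobenius_norm_def, Real.sqrt_eq_rpow]; simp
      rw [h1]
      exact Real.le_sqrt_of_sq_le h0
    have hY : Φ Y = ∑ a, ∑ b, Y a b • Φ (Matrix.single a b 1) := by
      conv_lhs => rw [Matrix.matrix_eq_sum_single Y]
      simp only [map_sum]
      refine Finset.sum_congr rfl fun a _ => Finset.sum_congr rfl fun b _ => ?_
      rw [← map_smul]
      simp
    unfold schatten2
    rw [hY, Finset.sum_mul]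
    refine (norm_sum_le _ _).trans (Finset.sum_le_sum fun a _ => ?_)
    rw [Finset.sum_mul]
    refine (norm_sum_le _ _).trans (Finset.sum_le_sum fun b _ => ?_)
    rw [norm_smul, mul_comm]
    exact mul_le_mul_of_nonneg_left (hentry a b) (norm_nonneg _)
  by_cases hX : X = 0
  · subst hX
    simp [schatten2]
  · have hpos : ∀ Y : {Y : Matrix J J ℂ // Y ≠ 0}, 0 < schatten2 (Y : Matrix J J ℂ) :=
      fun Y => norm_pos_iff.mpr Y.2
    have hbdd : BddAbove (Set.range fun Y : {Y : Matrix J J ℂ // Y ≠ 0} =>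
        schatten2 (Φ Y) / schatten2 (Y : Matrix J J ℂ)) := by
      refine ⟨∑ a, ∑ b, schatten2 (Φ (Matrix.single a b 1)), ?_⟩
      rintro _ ⟨Y, rfl⟩
      exact (div_le_iff₀ (hpos Y)).mpr (hb Y)
    exact (div_le_iff₀ (hpos ⟨X, hX⟩)).mp (le_ciSup hbdd ⟨X, hX⟩)

end Norm

end Twirl

end

/-! All three maps are orthogonal projections for the Hilbert–Schmidt inner product, and 𝒫 and 𝒬 fix
the range of ℛ. By `norm_comp_sub_le` it therefore suffices to bound ‖𝒬X‖ by η‖X‖ when 𝒫X = X and ℛX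
= 0.

By Schur–Weyl duality (`commute_tensorPower_of_unitary`, `exists_sum_permOp_of_commute`) such an X
is a combination ∑ c_σ v_σ of tensor products v_σ of permutation operators, with σ ∈ S_K^P. It is
orthogonal to the v_σ whose components all agree, and these are fixed by 𝒬.

Put x = K² ∑ q^(-2ℓ_p). The traces of the permutation operators on dimension n add up to
n(n+1)⋯(n+K-1), so after normalization by n^K the sum is at most exp(K²/(2n)): permutation operators
are nearly orthogonal (`sum_fixRatio_le`). Hence ‖X‖² ≥ N(1 - x) ∑ |c_σ|², where N = ‖v_σ‖²
(`le_norm_sq_sum_smul`).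

The form ⟨v_σ, 𝒬 v_τ⟩ factors into a part on the first ℓ_p qudits and a part on the other m_p - ℓ_p
(`inner_crosstwirl_permTensor`). Off the diagonal the first factor is bounded trivially, and the
second is summably small because m_p - ℓ_p ≥ 2ℓ_p. On the diagonal, for σ not constant, the first
factor is O(x): no single permutation can agree with two different components of σ
(`norm_sq_twirl_permTensor_le`). A Schur test (`norm_sq_proj_sum_le`) turns this into ‖𝒬X‖² ≤
25x‖X‖² for x ≤ 1/25; for larger x the asserted bound exceeds 1 and is trivial. -/

noncomputable section

namespace Twirl

open Equiv
open scoped Kronecker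

/-! ### Algebra of tensor powers. -/

section TensorPower

variable {ι : Type} {K : ℕ}

theorem tensorPower_mul [Fintype ι] (A B : Matrix ι ι ℂ) :
    tensorPower K (A * B) = tensorPower K A * tensorPower K B := by
  ext i j
  simp only [tensorPower, Matrix.of_apply, Matrix.mul_apply, ← Finset.prod_mul_distrib]
  rw [Finset.prod_univ_sum, Fintype.piFinset_univ]

theorem tensorPower_one [DecidableEq ι] : tensorPower K (1 : Matrix ι ι ℂ) = 1 := by
  ext i j
  simp only [tensorPower, Matrix.of_apply, Matrix.one_apply, Finset.prod_ite_zero,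
    Finset.prod_const_one, funext_iff, Finset.mem_univ, forall_const]

theorem tensorPower_conjTranspose (A : Matrix ι ι ℂ) :
    tensorPower K Aᴴ = (tensorPower K A)ᴴ := by
  ext i j
  simp [tensorPower]

theorem tensorPower_smul (c : ℂ) (A : Matrix ι ι ℂ) :
    tensorPower K (c • A) = c ^ K • tensorPower K A := by
  ext i j
  simp [tensorPower, Finset.prod_mul_distrib]

end TensorPower

/-! ### From unitaries to all matrices in the commutant condition. -/

section Density

variable {ι : Type} [Fintype ι] {K : ℕ}

/-- Commutation with the tensor powers of a polynomial family of matrices extends from real to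
complex parameters. -/
theorem commute_tensorPower_eval (X : Matrix (Fin K → ι) (Fin K → ι) ℂ)
    (W : Matrix ι ι (Polynomial ℂ))
    (h : ∀ t : ℝ, Commute X (tensorPower K (W.map (Polynomial.eval (t : ℂ))))) (z : ℂ) :
    Commute X (tensorPower K (W.map (Polynomial.eval z))) := by
  let p : (Fin K → ι) → (Fin K → ι) → Polynomial ℂ := fun i j =>
    ∑ a, Polynomial.C (X i a) * ∏ k, W (a k) (j k) - ∑ a, (∏ k, W (i k) (a k)) * Polynomial.C (X a j)
  have heval : ∀ (w : ℂ) i j, (p i j).eval w =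
      (X * tensorPower K (W.map (Polynomial.eval w))) i j -
        (tensorPower K (W.map (Polynomial.eval w)) * X) i j := by
    intro w i j
    simp [p, Matrix.mul_apply, tensorPower, Polynomial.eval_finsetSum, Polynomial.eval_prod]
  have hp : ∀ i j, p i j = 0 := by
    intro i j
    refine Polynomial.eq_zero_of_infinite_isRoot _ ?_
    -- Each entry of the commutator is a polynomial in the parameter which vanishes at all real
    -- numbers.
    refine (Set.infinite_range_of_injective Complex.ofReal_injective).mono ?_
    rintro _ ⟨t, rfl⟩
    simp only [Set.mem_ofPred_eq, Polynomial.IsRoot, heval]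
    rw [(h t).eq, sub_self]
  ext i j
  have := heval z i j
  rw [hp, Polynomial.eval_zero] at this
  exact (sub_eq_zero.mp this.symm)

variable [DecidableEq ι]

open scoped ComplexOrder in
-- The product (1 + S)(1 - S) equals 1 + S†S, which is positive definite.
theorem isUnit_one_sub_of_skew {S : Matrix ι ι ℂ} (hS : Sᴴ = -S) : IsUnit (1 - S) := by
  have hpd : (1 + Sᴴ * S : Matrix ι ι ℂ).PosDef :=
    Matrix.PosDef.one.add_posSemidef (Matrix.posSemidef_conjTranspose_mul_self S)
  have hu := hpd.isUnit
  have he : (1 + Sᴴ * S : Matrix ι ι ℂ) = (1 + S) * (1 - S) := by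
    rw [hS]; noncomm_ring
  rw [he, Matrix.isUnit_iff_isUnit_det, Matrix.det_mul] at hu
  exact (Matrix.isUnit_iff_isUnit_det _).mpr (isUnit_of_mul_isUnit_right hu)

theorem cayley_mem_unitaryGroup {S : Matrix ι ι ℂ} (hS : Sᴴ = -S) :
    (1 + S) * (1 - S)⁻¹ ∈ Matrix.unitaryGroup ι ℂ := by
  have h1 := isUnit_one_sub_of_skew hS
  have h2 : IsUnit (1 + S) := by
    have := isUnit_one_sub_of_skew (S := -S) (by rw [Matrix.conjTranspose_neg, hS])
    simpa using this
  have d1 := (Matrix.isUnit_iff_isUnit_det _).mp h1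
  have d2 := (Matrix.isUnit_iff_isUnit_det _).mp h2
  rw [Matrix.mem_unitaryGroup_iff']
  rw [Matrix.star_eq_conjTranspose, Matrix.conjTranspose_mul, Matrix.conjTranspose_nonsing_inv,
    Matrix.conjTranspose_add, Matrix.conjTranspose_sub, hS, Matrix.conjTranspose_one, sub_neg_eq_add,
    ← sub_eq_add_neg]
  have hc : (1 - S) * (1 + S) = (1 + S) * (1 - S) := by noncomm_ring
  calc (1 + S)⁻¹ * (1 - S) * ((1 + S) * (1 - S)⁻¹)
      = (1 + S)⁻¹ * ((1 - S) * (1 + S)) * (1 - S)⁻¹ := by simp only [mul_assoc]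
    _ = ((1 + S)⁻¹ * (1 + S)) * ((1 - S) * (1 - S)⁻¹) := by rw [hc]; simp only [mul_assoc]
    _ = 1 := by rw [Matrix.nonsing_inv_mul _ d2, Matrix.mul_nonsing_inv _ d1, one_mul]

/-- Unitarian trick through the Cayley transform, which takes skew-Hermitian matrices to unitaries.
Every matrix is S₁ + iS₂ with both Sᵢ skew-Hermitian, so polynomial continuation from real to
complex parameters reaches all Cayley transforms; these include every B with 1 + B invertible, and
rescaling gives the rest. -/
theorem commute_tensorPower_of_unitary (X : Matrix (Fin K → ι) (Fin K → ι) ℂ)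
    (h : ∀ U ∈ Matrix.unitaryGroup ι ℂ, Commute X (tensorPower K U)) (A : Matrix ι ι ℂ) :
    Commute X (tensorPower K A) := by
  -- The adjugate replaces the inverse to make the family polynomial; the determinant is only a
  -- scalar factor.
  have hskew : ∀ S : Matrix ι ι ℂ, Sᴴ = -S →
      Commute X (tensorPower K ((1 + S) * (1 - S).adjugate)) := by
    intro S hS
    have hd := (Matrix.isUnit_iff_isUnit_det _).mp (isUnit_one_sub_of_skew hS)
    have : (1 + S) * (1 - S).adjugate = (1 - S).det • ((1 + S) * (1 - S)⁻¹) := by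
      rw [Matrix.inv_def, Matrix.mul_smul, smul_smul, Ring.mul_inverse_cancel _ hd, one_smul]
    rw [this, tensorPower_smul]
    exact (h _ (cayley_mem_unitaryGroup hS)).smul_right _
  have hall : ∀ M : Matrix ι ι ℂ, Commute X (tensorPower K ((1 + M) * (1 - M).adjugate)) := by
    intro M
    obtain ⟨S₁, S₂, h₁, h₂, hM⟩ : ∃ S₁ S₂ : Matrix ι ι ℂ, S₁ᴴ = -S₁ ∧ S₂ᴴ = -S₂ ∧
        M = S₁ + Complex.I • S₂ := by
      refine ⟨(1 / 2 : ℂ) • (M - Mᴴ), (-Complex.I / 2) • (M + Mᴴ), ?_, ?_, ?_⟩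
      · ext i j
        simp
        ring
      · ext i j
        simp
        ring
      · ext i j
        simp only [Matrix.add_apply, Matrix.smul_apply, Matrix.sub_apply, smul_eq_mul]
        linear_combination (1 / 2 : ℂ) * (M i j + Mᴴ i j) * Complex.I_mul_I
    -- The pencil S₁ + zS₂ is skew-Hermitian for real z and equals M at z = i.
    let N : Matrix ι ι (Polynomial ℂ) :=
      S₁.map Polynomial.C + (Polynomial.X : Polynomial ℂ) • S₂.map Polynomial.C
    have hN : ∀ z : ℂ, (Polynomial.evalRingHom z).mapMatrix N = S₁ + z • S₂ := by
      intro z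
      ext i j
      simp [N]
      exact mul_comm _ _
    have hW : ∀ z : ℂ, ((1 + N) * (1 - N).adjugate).map (Polynomial.eval z) =
        (1 + (S₁ + z • S₂)) * (1 - (S₁ + z • S₂)).adjugate := by
      intro z
      have : ((1 + N) * (1 - N).adjugate).map (Polynomial.eval z) =
        (Polynomial.evalRingHom z).mapMatrix ((1 + N) * (1 - N).adjugate) := rfl
      rw [this, map_mul, RingHom.map_adjugate, map_add, map_sub, map_one, hN]
    have := commute_tensorPower_eval X ((1 + N) * (1 - N).adjugate) (fun t => by
      rw [hW]
      refine hskew _ ?_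
      rw [Matrix.conjTranspose_add, Matrix.conjTranspose_smul, h₁, h₂]
      simp [add_comm]) Complex.I
    rwa [hW, ← hM] at this
  have hinv : ∀ B : Matrix ι ι ℂ, IsUnit (1 + B).det → Commute X (tensorPower K B) := by
    intro B hB
    -- Inverse Cayley transform: B = (1 + M)(1 - M)⁻¹.
    let M : Matrix ι ι ℂ := (B - 1) * (1 + B)⁻¹
    have e1 : (1 + B) * (1 + B)⁻¹ = 1 := Matrix.mul_nonsing_inv _ hB
    have hm : 1 - M = (2 : ℂ) • (1 + B)⁻¹ := by
      calc 1 - M = (1 + B) * (1 + B)⁻¹ - (B - 1) * (1 + B)⁻¹ := by rw [e1]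
        _ = ((1 + B) - (B - 1)) * (1 + B)⁻¹ := by rw [sub_mul (1 + B)]
        _ = _ := by
          rw [show (1 + B) - (B - 1) = (2 : ℂ) • (1 : Matrix ι ι ℂ) by
            rw [two_smul]; abel, Matrix.smul_mul, one_mul]
    have hp : 1 + M = B * (1 - M) := by
      rw [hm]
      calc 1 + M = (1 + B) * (1 + B)⁻¹ + (B - 1) * (1 + B)⁻¹ := by rw [e1]
        _ = ((1 + B) + (B - 1)) * (1 + B)⁻¹ := by rw [add_mul (1 + B)]
        _ = _ := by
          rw [show (1 + B) + (B - 1) = (2 : ℂ) • B by rw [two_smul]; abel,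
            Matrix.smul_mul, Matrix.mul_smul]
    have hd : (1 - M).det ≠ 0 := by
      rw [hm, Matrix.det_smul]
      refine mul_ne_zero (pow_ne_zero _ two_ne_zero) ?_
      exact ((Matrix.isUnit_nonsing_inv_det_iff).mpr hB).ne_zero
    have := hall M
    rw [hp, mul_assoc, Matrix.mul_adjugate, Matrix.mul_smul, mul_one, tensorPower_smul] at this
    have h2 := this.smul_right ((((1 - M).det) ^ K)⁻¹)
    rwa [smul_smul, inv_mul_cancel₀ (pow_ne_zero _ hd), one_smul] at h2
  -- Since det(1 + tA) is 1 at t = 0, some nonzero t makes 1 + tA invertible.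
  have hcont : Continuous fun t : ℂ => (1 + t • A).det := by fun_prop
  have hev : ∀ᶠ t in nhdsWithin (0 : ℂ) {0}ᶜ, (1 + t • A).det ≠ 0 := by
    refine Filter.Eventually.filter_mono nhdsWithin_le_nhds (hcont.continuousAt.eventually_ne ?_)
    simp
  obtain ⟨t, ht, ht0⟩ := (hev.and self_mem_nhdsWithin).exists
  have := hinv (t • A) (isUnit_iff_ne_zero.mpr ht)
  rw [tensorPower_smul] at this
  have h2 := this.smul_right ((t ^ K)⁻¹)
  rwa [smul_smul, inv_mul_cancel₀ (pow_ne_zero _ ht0), one_smul] at h2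

end Density

/-! ### Schur–Weyl duality: the commutant of the tensor powers. -/

section PermOp

variable {ι : Type} [DecidableEq ι] {K : ℕ}

/-- The operator permuting the `K` tensor factors by `σ`. -/
def permOp (ι : Type) [DecidableEq ι] {K : ℕ} (σ : Perm (Fin K)) :
    Matrix (Fin K → ι) (Fin K → ι) ℂ :=
  Matrix.of fun i j => if i = j ∘ σ then 1 else 0

theorem permOp_commute_tensorPower [Fintype ι] (σ : Perm (Fin K)) (A : Matrix ι ι ℂ) :
    Commute (permOp ι σ) (tensorPower K A) := by
  ext i j
  have h1 : (permOp ι σ * tensorPower K A) i j = tensorPower K A (i ∘ σ.symm) j := by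
    rw [Matrix.mul_apply, Finset.sum_eq_single (i ∘ σ.symm)]
    · simp [permOp, Function.comp_assoc]
    · intro b _ hb
      have : ¬ i = b ∘ σ := by
        rintro rfl
        exact hb (by simp [Function.comp_assoc])
      simp [permOp, this]
    · simp
  have h2 : (tensorPower K A * permOp ι σ) i j = tensorPower K A i (j ∘ σ) := by
    rw [Matrix.mul_apply, Finset.sum_eq_single (j ∘ σ)]
    · simp [permOp]
    · intro b _ hb
      simp [permOp, hb]
    · simp
  rw [h1, h2]
  simp only [tensorPower, Matrix.of_apply]
  exact Fintype.prod_equiv σ.symm _ _ fun k => by simp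

/-- An operator on `K ≤ dim` copies commuting with all tensor powers is a combination of
permutation operators. -/
theorem exists_sum_permOp_of_commute [Fintype ι] (hK : K ≤ Fintype.card ι)
    (X : Matrix (Fin K → ι) (Fin K → ι) ℂ) (h : ∀ A, Commute X (tensorPower K A)) :
    ∃ c : Perm (Fin K) → ℂ, X = ∑ σ, c σ • permOp ι σ := by
  obtain ⟨f⟩ : Nonempty (Fin K ↪ ι) :=
    Function.Embedding.nonempty_of_card_le (by simpa using hK)
  -- If a is not a rearrangement of the injective word f, it misses some letter f k₀. The diagonal
  -- projection killing that letter annihilates column f and preserves row a.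
  have hsupp : ∀ a : Fin K → ι, a ∉ Set.range (fun σ : Perm (Fin K) => f ∘ σ) → X a f = 0 := by
    intro a ha
    have hex : ∃ k₀, ∀ k, a k ≠ f k₀ := by
      by_contra! hcon
      choose g hg using hcon
      have hgi : Function.Injective g := fun x y hxy => f.injective (by rw [← hg, ← hg, hxy])
      have hgb := Finite.injective_iff_bijective.mp hgi
      refine ha ⟨(Equiv.ofBijective g hgb).symm, ?_⟩
      funext k
      have := hg ((Equiv.ofBijective g hgb).symm k)
      refine this.symm.trans ?_
      exact congrArg a ((Equiv.ofBijective g hgb).apply_symm_apply k)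
    obtain ⟨k₀, hk₀⟩ := hex
    have hc := congrFun (congrFun
      (h (Matrix.diagonal fun x => if x = f k₀ then (0 : ℂ) else 1)).eq a) f
    have hdiag : tensorPower K (Matrix.diagonal fun x => if x = f k₀ then (0 : ℂ) else 1) =
        Matrix.diagonal fun i : Fin K → ι => ∏ k, if i k = f k₀ then (0 : ℂ) else 1 := by
      ext i j
      by_cases hij : i = j
      · subst hij
        simp [tensorPower]
      · obtain ⟨k, hk⟩ := Function.ne_iff.mp hij
        rw [Matrix.diagonal_apply_ne _ hij]
        exact Finset.prod_eq_zero (Finset.mem_univ k) (Matrix.diagonal_apply_ne _ hk)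
    rw [hdiag, Matrix.mul_diagonal, Matrix.diagonal_mul] at hc
    rw [Finset.prod_eq_zero (Finset.mem_univ k₀) (by simp), mul_zero,
      Finset.prod_eq_one (fun k _ => by simp [hk₀ k]), one_mul] at hc
    exact hc.symm
  refine ⟨fun σ => X (f ∘ σ) f, ?_⟩
  ext i j
  -- A maps the basis vector f k to j k, so its tensor power carries f to j. Column f of X thus
  -- determines every column.
  let A : Matrix ι ι ℂ := Matrix.of fun x y => if ∃ k, y = f k ∧ x = j k then 1 else 0
  have hA : ∀ x k, A x (f k) = if x = j k then 1 else 0 := by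
    intro x k
    have : (∃ k', f k = f k' ∧ x = j k') ↔ x = j k := by
      constructor
      · rintro ⟨k', h1, h2⟩
        rwa [f.injective h1]
      · exact fun hx => ⟨k, rfl, hx⟩
    simp only [A, Matrix.of_apply, this]
  have hT : ∀ (a : Fin K → ι) (σ : Fin K → Fin K),
      tensorPower K A a (f ∘ σ) = if a = j ∘ σ then 1 else 0 := by
    intro a σ
    simp only [tensorPower, Matrix.of_apply, Function.comp_apply, hA, Finset.prod_ite_zero,
      Finset.prod_const_one, Finset.mem_univ, forall_const, funext_iff]
  have hc := congrFun (congrFun (h A).eq i) f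
  have hl : (X * tensorPower K A) i f = X i j := by
    rw [Matrix.mul_apply]
    have : ∀ b, tensorPower K A b f = if b = j then 1 else 0 := fun b => hT b id
    simp [this]
  have hr : (tensorPower K A * X) i f = ∑ σ : Perm (Fin K), X (f ∘ σ) f * permOp ι σ i j := by
    rw [Matrix.mul_apply]
    refine (Fintype.sum_of_injective (fun σ : Perm (Fin K) => f ∘ σ) ?_ _ _ ?_ ?_).symm
    · intro σ τ hστ
      ext k
      exact congrArg Fin.val (f.injective (congrFun hστ k))
    · intro a ha
      rw [hsupp a ha, mul_zero]
    · intro σ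
      rw [hT, mul_comm]
      rfl
  rw [← hl, hc, hr]
  simp [Matrix.sum_apply]

end PermOp

/-! ### The Hilbert–Schmidt inner product. -/

section Frobenius

attribute [local instance] Matrix.frobeniusNormedAddCommGroup Matrix.frobeniusNormedSpace

/-- The Hilbert–Schmidt inner product `tr(X† Y)`, compatible with the Frobenius norm. -/
@[reducible]
def frobeniusInnerProductSpace (J : Type) [Fintype J] : InnerProductSpace ℂ (Matrix J J ℂ) where
  inner X Y := (Xᴴ * Y).trace
  norm_sq_eq_re_inner X := by
    have h := schatten2_eq X
    rw [schatten2] at h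
    rw [h, Real.sq_sqrt]
    · rfl
    · simp only [Matrix.trace, Matrix.diag, Matrix.mul_apply, Matrix.conjTranspose_apply,
        Complex.re_sum]
      refine Finset.sum_nonneg fun i _ => Finset.sum_nonneg fun j _ => ?_
      rw [Complex.star_def, ← Complex.normSq_eq_conj_mul_self, Complex.ofReal_re]
      exact Complex.normSq_nonneg _
  conj_inner_symm X Y := by
    rw [starRingEnd_apply, ← Matrix.trace_conjTranspose, Matrix.conjTranspose_mul,
      Matrix.conjTranspose_conjTranspose]
  add_left X Y Z := by
    rw [Matrix.conjTranspose_add, Matrix.add_mul, Matrix.trace_add]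
  smul_left X Y c := by
    rw [Matrix.conjTranspose_smul, Matrix.smul_mul, Matrix.trace_smul]
    rfl

attribute [local instance] frobeniusInnerProductSpace

theorem inner_eq_trace {J : Type} [Fintype J] (X Y : Matrix J J ℂ) :
    inner ℂ X Y = (Xᴴ * Y).trace := rfl

theorem inner_eq_sum {J : Type} [Fintype J] (X Y : Matrix J J ℂ) :
    inner ℂ X Y = ∑ i, ∑ j, star (X i j) * Y i j := by
  rw [inner_eq_trace, Finset.sum_comm]
  rfl

end Frobenius

/-! ### Haar averages as orthogonal projections. -/

section Haar

instance instIsHaarMeasureHaarUnitary (κ : Type) [Fintype κ] [DecidableEq κ] :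
    (haarUnitary κ).IsHaarMeasure := by
  unfold haarUnitary; infer_instance


/-- Uniqueness of the Haar probability measure gives right invariance. The inverted measure is then
left invariant, hence a multiple of the original one, and total mass 1 fixes the factor. -/
instance instIsInvInvariantHaarUnitary (κ : Type) [Fintype κ] [DecidableEq κ] :
    (haarUnitary κ).IsInvInvariant := by
  have hr : (haarUnitary κ).IsMulRightInvariant := by
    refine ⟨fun g => ?_⟩
    have : MeasureTheory.IsProbabilityMeasure ((haarUnitary κ).map (· * g)) :=
      MeasureTheory.Measure.isProbabilityMeasure_map (by fun_prop)
    exact MeasureTheory.Measure.isHaarMeasure_eq_of_isProbabilityMeasure _ _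
  have hp : MeasureTheory.IsProbabilityMeasure (haarUnitary κ).inv :=
    MeasureTheory.Measure.isProbabilityMeasure_map (by fun_prop)
  have h := MeasureTheory.Measure.isMulInvariant_eq_smul_of_compactSpace
    (haarUnitary κ).inv (haarUnitary κ)
  have hu := congrArg (fun μ => μ Set.univ) h
  simp only [MeasureTheory.measure_univ, MeasureTheory.Measure.smul_apply, ENNReal.smul_def,
    smul_eq_mul, mul_one, ENNReal.one_eq_coe] at hu
  refine ⟨?_⟩
  rw [h, ← hu, one_smul]

variable {κ ι : Type} [Fintype κ] [DecidableEq κ] [Fintype ι] [DecidableEq ι] {K : ℕ}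
  (V : C(Matrix.unitaryGroup κ ℂ, Matrix ι ι ℂ))

theorem haarAverage_functional (φ : Matrix (Fin K → ι) (Fin K → ι) ℂ →ₗ[ℂ] ℂ)
    (X : Matrix (Fin K → ι) (Fin K → ι) ℂ) :
    φ (haarAverage K V X) =
      ∫ U, φ (tensorPower K (V U) * X * (tensorPower K (V U))ᴴ) ∂(haarUnitary κ) := by
  have hφ : ∀ M, φ M = ∑ i, ∑ j, M i j * φ (Matrix.single i j 1) := by
    intro M
    conv_lhs => rw [Matrix.matrix_eq_sum_single M]
    simp only [map_sum]
    refine Finset.sum_congr rfl fun i _ => Finset.sum_congr rfl fun j _ => ?_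
    rw [← smul_eq_mul, ← map_smul]
    simp
  have hi : ∀ i j, MeasureTheory.Integrable
      (fun U => (tensorPower K (V U) * X * (tensorPower K (V U))ᴴ) i j) (haarUnitary κ) :=
    fun i j => ((continuous_tensorPower_conj K V X).matrix_elem i j).integrable_of_hasCompactSupport
      (HasCompactSupport.of_compactSpace _)
  rw [hφ]
  simp_rw [hφ (tensorPower K (V _) * X * (tensorPower K (V _))ᴴ)]
  rw [MeasureTheory.integral_finsetSum _ fun i _ =>
    MeasureTheory.integrable_finsetSum _ fun j _ => (hi i j).mul_const _]
  refine Finset.sum_congr rfl fun i _ => ?_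
  rw [MeasureTheory.integral_finsetSum _ fun j _ => (hi i j).mul_const _]
  refine Finset.sum_congr rfl fun j _ => ?_
  rw [MeasureTheory.integral_mul_const]
  rfl

theorem haarAverage_eq_self {X : Matrix (Fin K → ι) (Fin K → ι) ℂ}
    (hstar : ∀ U, V U * (V U)ᴴ = 1) (hX : ∀ U, Commute X (tensorPower K (V U))) :
    haarAverage K V X = X := by
  ext i j
  have h : ∀ U, tensorPower K (V U) * X * (tensorPower K (V U))ᴴ = X := by
    intro U
    rw [← (hX U).eq, mul_assoc, ← tensorPower_conjTranspose, ← tensorPower_mul, hstar,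
      tensorPower_one, mul_one]
  simp [haarAverage, h]

theorem haarAverage_commute (hmul : ∀ U W, V (U * W) = V U * V W)
    (hstar : ∀ U, (V U)ᴴ * V U = 1)
    (X : Matrix (Fin K → ι) (Fin K → ι) ℂ) (W : Matrix.unitaryGroup κ ℂ) :
    Commute (haarAverage K V X) (tensorPower K (V W)) := by
  have h : tensorPower K (V W) * haarAverage K V X * (tensorPower K (V W))ᴴ =
      haarAverage K V X := by
    ext i j
    let φ : Matrix (Fin K → ι) (Fin K → ι) ℂ →ₗ[ℂ] ℂ :=
      { toFun := fun M => (tensorPower K (V W) * M * (tensorPower K (V W))ᴴ) i j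
        map_add' := fun M N => by simp [mul_add, add_mul]
        map_smul' := fun c M => by simp }
    have h1 := haarAverage_functional V φ X
    have h2 : ∀ U, φ (tensorPower K (V U) * X * (tensorPower K (V U))ᴴ) =
        (tensorPower K (V (W * U)) * X * (tensorPower K (V (W * U)))ᴴ) i j := by
      intro U
      simp only [φ, LinearMap.coe_mk, AddHom.coe_mk, hmul, tensorPower_mul,
        Matrix.conjTranspose_mul, mul_assoc]
    simp_rw [h2] at h1
    rw [MeasureTheory.integral_mul_left_eq_self (fun U =>
      (tensorPower K (V U) * X * (tensorPower K (V U))ᴴ) i j) W] at h1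
    exact h1
  have h3 : (tensorPower K (V W))ᴴ * tensorPower K (V W) = 1 := by
    rw [← tensorPower_conjTranspose, ← tensorPower_mul, hstar, tensorPower_one]
  rw [commute_iff_eq]
  nth_rewrite 1 [← h]
  rw [mul_assoc, h3, mul_one]

attribute [local instance] Matrix.frobeniusNormedAddCommGroup Matrix.frobeniusNormedSpace
  frobeniusInnerProductSpace

theorem haarAverage_isSymmetric (hinv : ∀ U, V U⁻¹ = (V U)ᴴ) :
    (haarAverage K V).IsSymmetric := by
  intro X Y
  have h1 := haarAverage_functional V (innerₛₗ ℂ Y) X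
  have h2 := haarAverage_functional V (innerₛₗ ℂ X) Y
  simp only [innerₛₗ_apply_apply] at h1 h2
  -- The adjoint of conjugation by V(U) is conjugation by V(U⁻¹), and Haar measure is invariant
  -- under inversion.
  rw [← inner_conj_symm, h1, h2, ← integral_conj, ← MeasureTheory.integral_inv_eq_self]
  refine MeasureTheory.integral_congr_ae (Filter.Eventually.of_forall fun U => ?_)
  beta_reduce
  rw [inner_conj_symm]
  simp only [inner_eq_trace, hinv, tensorPower_conjTranspose, Matrix.conjTranspose_mul,
    Matrix.conjTranspose_conjTranspose]
  rw [← mul_assoc, ← mul_assoc, Matrix.trace_mul_comm]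
  simp only [mul_assoc]
  rw [← mul_assoc, Matrix.trace_mul_comm]
  simp only [mul_assoc]

end Haar

/-! ### The full twirl as the projection onto the span of permutation operators. -/

section Twirl

variable (K : ℕ) (ι : Type) [Fintype ι] [DecidableEq ι]

attribute [local instance] Matrix.frobeniusNormedAddCommGroup Matrix.frobeniusNormedSpace
  frobeniusInnerProductSpace

theorem twirl_isSymmetric : (twirl K ι).IsSymmetric :=
  haarAverage_isSymmetric _ fun _ => rfl

theorem twirl_permOp (σ : Perm (Fin K)) : twirl K ι (permOp ι σ) = permOp ι σ :=
  haarAverage_eq_self (κ := ι) ⟨fun U => (U : Matrix ι ι ℂ), continuous_subtype_val⟩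
    (fun U => Matrix.mem_unitaryGroup_iff.mp U.2)
    fun _ => permOp_commute_tensorPower _ _

theorem exists_twirl_eq_sum_permOp (hK : K ≤ Fintype.card ι)
    (X : Matrix (Fin K → ι) (Fin K → ι) ℂ) :
    ∃ c : Perm (Fin K) → ℂ, twirl K ι X = ∑ σ, c σ • permOp ι σ := by
  refine exists_sum_permOp_of_commute hK _ (commute_tensorPower_of_unitary _ fun U hU => ?_)
  exact haarAverage_commute (κ := ι) ⟨fun U => (U : Matrix ι ι ℂ), continuous_subtype_val⟩
    (fun _ _ => rfl) (fun U => Matrix.mem_unitaryGroup_iff'.mp U.2) X ⟨U, hU⟩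

end Twirl

/-! ### Traces of permutation operators. -/

section FixCount

variable (ι : Type) [Fintype ι] [DecidableEq ι] {K : ℕ}

/-- The number of functions `Fin K → ι` that are invariant under the permutation `σ`, that is,
the trace of the permutation operator of `σ`. -/
def fixCount (σ : Perm (Fin K)) : ℕ := ∑ j : Fin K → ι, if j ∘ σ = j then 1 else 0

theorem fixCount_one : fixCount ι (1 : Perm (Fin K)) = Fintype.card ι ^ K := by
  simp [fixCount]

theorem fixCount_le (σ : Perm (Fin K)) : fixCount ι σ ≤ Fintype.card ι ^ K := by
  rw [← fixCount_one, fixCount, fixCount]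
  exact Finset.sum_le_sum fun j _ => by split_ifs <;> simp_all

theorem fixCount_prod (κ : Type) [Fintype κ] [DecidableEq κ] (σ : Perm (Fin K)) :
    fixCount (ι × κ) σ = fixCount ι σ * fixCount κ σ := by
  rw [fixCount, fixCount, fixCount, Finset.sum_mul_sum, ← Fintype.sum_prod_type']
  refine Fintype.sum_equiv (Equiv.arrowProdEquivProdArrow (Fin K) (fun _ => ι) (fun _ => κ)) _ _
    fun j => ?_
  rw [ite_zero_mul_ite_zero, mul_one]
  refine if_congr ?_ rfl rfl
  simp [funext_iff, Prod.ext_iff, forall_and]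

/-- A permutation of K + 1 points is a swap of 0 with p following a permutation e of the last K
points. A word is invariant exactly when its letter at p equals its first letter and its tail is
e-invariant. For p = 0 the first letter is free; each of the K other p determines it. -/
theorem sum_fixCount_succ (K : ℕ) : ∑ σ : Perm (Fin (K + 1)), fixCount ι σ =
    (Fintype.card ι + K) * ∑ σ : Perm (Fin K), fixCount ι σ := by
  have hcond : ∀ (p : Fin (K + 1)) (e : Perm (Fin K)) (x : ι) (t : Fin K → ι),
      (Fin.cons x t : Fin (K + 1) → ι) ∘ Perm.decomposeFin.symm (p, e) = Fin.cons x t ↔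
        (Fin.cons x t : Fin (K + 1) → ι) p = x ∧ t ∘ e = t := by
    intro p e x t
    have hswap : (Fin.cons x t : Fin (K + 1) → ι) p = x → ∀ y,
        (Fin.cons x t : Fin (K + 1) → ι) (swap 0 p y) = (Fin.cons x t : Fin (K + 1) → ι) y := by
      intro h y
      rw [swap_apply_def]
      split_ifs with h0 h1
      · rw [h0, h]; rfl
      · rw [h1, h]; rfl
      · rfl
    rw [funext_iff, Fin.forall_fin_succ]
    simp only [Function.comp_apply, Perm.decomposeFin_symm_apply_zero,
      Perm.decomposeFin_symm_apply_succ, Fin.cons_zero, Fin.cons_succ]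
    refine and_congr_right fun h => ?_
    simp only [hswap h, Fin.cons_succ, funext_iff, Function.comp_apply]
  have hsplit : ∀ σ : Perm (Fin (K + 1)), fixCount ι σ =
      ∑ x : ι, ∑ t : Fin K → ι, if (Fin.cons x t : Fin (K + 1) → ι) ∘ σ = Fin.cons x t
        then 1 else 0 := by
    intro σ
    rw [fixCount, ← Fintype.sum_prod_type']
    exact (Fintype.sum_equiv (Fin.consEquiv fun _ => ι) _ _ fun _ => rfl).symm
  rw [← Equiv.sum_comp Perm.decomposeFin.symm, Fintype.sum_prod_type_right, Finset.mul_sum]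
  refine Finset.sum_congr rfl fun e _ => ?_
  simp only [hsplit, hcond]
  rw [Fin.sum_univ_succ]
  simp only [Fin.cons_zero, Fin.cons_succ, true_and, Finset.sum_const, Finset.card_univ,
    smul_eq_mul]
  rw [add_mul, fixCount]
  congr 1
  have : ∀ p : Fin K, (∑ x : ι, ∑ t : Fin K → ι, if t p = x ∧ t ∘ e = t then 1 else 0) =
      ∑ t : Fin K → ι, if t ∘ e = t then 1 else 0 := by
    intro p
    rw [Finset.sum_comm]
    refine Finset.sum_congr rfl fun t _ => ?_
    simp only [ite_and]
    simp
  rw [Finset.sum_congr rfl fun p _ => this p, Finset.sum_const, Finset.card_univ, Fintype.card_fin,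
    smul_eq_mul]

/-- The sum is the rising factorial n(n+1)⋯(n+K-1), and 1 + j/n ≤ e^(j/n). -/
theorem sum_fixCount_le [Nonempty ι] (K : ℕ) : (∑ σ : Perm (Fin K), fixCount ι σ : ℝ) ≤
    (Fintype.card ι : ℝ) ^ K * Real.exp ((K : ℝ) ^ 2 / (2 * Fintype.card ι)) := by
  have hn : (0 : ℝ) < Fintype.card ι := by exact_mod_cast Fintype.card_pos
  set n : ℝ := (Fintype.card ι : ℝ)
  induction K with
  | zero =>
    have : (∑ σ : Perm (Fin 0), (fixCount ι σ : ℝ)) ≤ ∑ σ : Perm (Fin 0), 1 :=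
      Finset.sum_le_sum fun σ _ => by exact_mod_cast fixCount_le ι σ
    simpa using this
  | succ K ih =>
    have h : (∑ σ : Perm (Fin (K + 1)), (fixCount ι σ : ℝ)) =
        (n + K) * ∑ σ : Perm (Fin K), (fixCount ι σ : ℝ) := by
      simp only [n]
      exact_mod_cast sum_fixCount_succ ι K
    have h1 : n + K ≤ n * Real.exp (K / n) := by
      have := mul_le_mul_of_nonneg_left (Real.add_one_le_exp (K / n)) hn.le
      calc n + K = n * (K / n + 1) := by field_simp; ring
        _ ≤ _ := this
    rw [h]
    calc (n + K) * ∑ σ : Perm (Fin K), (fixCount ι σ : ℝ)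
        ≤ (n * Real.exp (K / n)) * (n ^ K * Real.exp ((K : ℝ) ^ 2 / (2 * n))) :=
          mul_le_mul h1 ih (by positivity) (by positivity)
      _ = n ^ (K + 1) * Real.exp (K / n + (K : ℝ) ^ 2 / (2 * n)) := by
          rw [Real.exp_add]; ring
      _ ≤ _ := by
          refine mul_le_mul_of_nonneg_left (Real.exp_le_exp.mpr ?_) (by positivity)
          rw [div_add_div _ _ hn.ne' (by positivity), div_le_div_iff₀ (by positivity) (by positivity)]
          push_cast
          have : 0 < n ^ 2 := by positivity
          nlinarith

/-- The normalized trace of the permutation operator of `σ`. -/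
def fixRatio (σ : Perm (Fin K)) : ℝ := fixCount ι σ / (Fintype.card ι : ℝ) ^ K

theorem fixRatio_nonneg (σ : Perm (Fin K)) : 0 ≤ fixRatio ι σ := by
  unfold fixRatio; positivity

theorem fixRatio_one [Nonempty ι] : fixRatio ι (1 : Perm (Fin K)) = 1 := by
  have hn : (Fintype.card ι : ℝ) ≠ 0 := by exact_mod_cast Fintype.card_ne_zero
  rw [fixRatio, fixCount_one, Nat.cast_pow, div_self (pow_ne_zero _ hn)]

theorem fixRatio_le_one (σ : Perm (Fin K)) : fixRatio ι σ ≤ 1 :=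
  div_le_one_of_le₀ (by exact_mod_cast fixCount_le ι σ) (by positivity)

theorem fixRatio_prod (κ : Type) [Fintype κ] [DecidableEq κ] (σ : Perm (Fin K)) :
    fixRatio (ι × κ) σ = fixRatio ι σ * fixRatio κ σ := by
  rw [fixRatio, fixRatio, fixRatio, fixCount_prod, Fintype.card_prod]
  push_cast
  rw [mul_pow, mul_div_mul_comm]

theorem sum_fixRatio_le [Nonempty ι] (K : ℕ) : ∑ σ : Perm (Fin K), fixRatio ι σ ≤
    Real.exp ((K : ℝ) ^ 2 / (2 * Fintype.card ι)) := by
  have hn : (0 : ℝ) < Fintype.card ι := by exact_mod_cast Fintype.card_pos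
  simp only [fixRatio]
  rw [← Finset.sum_div, div_le_iff₀ (by positivity), mul_comm]
  exact sum_fixCount_le ι K

end FixCount

section FixRatioFamily

variable {P K : ℕ} (ι : Fin P → Type) [∀ p, Fintype (ι p)] [∀ p, DecidableEq (ι p)]

/-- The normalized trace of a tensor product of permutation operators. -/
def fixRatioProd (σ : Fin P → Perm (Fin K)) : ℝ := ∏ p, fixRatio (ι p) (σ p)

theorem fixRatioProd_nonneg (σ : Fin P → Perm (Fin K)) : 0 ≤ fixRatioProd ι σ :=
  Finset.prod_nonneg fun p _ => fixRatio_nonneg (ι p) (σ p)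

theorem fixRatioProd_one [∀ p, Nonempty (ι p)] :
    fixRatioProd ι (1 : Fin P → Perm (Fin K)) = 1 :=
  Finset.prod_eq_one fun p _ => fixRatio_one (ι p)

theorem sum_fixRatioProd_le [∀ p, Nonempty (ι p)] :
    ∑ σ : Fin P → Perm (Fin K), fixRatioProd ι σ ≤
      Real.exp (∑ p, (K : ℝ) ^ 2 / (2 * Fintype.card (ι p))) := by
  simp only [fixRatioProd]
  rw [← Fintype.piFinset_univ, ← Finset.prod_univ_sum, Real.exp_sum]
  exact Finset.prod_le_prod (fun p _ => Finset.sum_nonneg fun σ _ => fixRatio_nonneg (ι p) σ)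
    fun p _ => sum_fixRatio_le (ι p) K

end FixRatioFamily

/-! ### Gram matrices of permutation operators and their tensor products. -/

section Inner

attribute [local instance] Matrix.frobeniusNormedAddCommGroup Matrix.frobeniusNormedSpace
  frobeniusInnerProductSpace

theorem inner_submatrix_equiv {I J : Type} [Fintype I] [Fintype J] (e : I ≃ J)
    (X Y : Matrix J J ℂ) : inner ℂ (X.submatrix e e) (Y.submatrix e e) = inner ℂ X Y := by
  simp only [inner_eq_sum, Matrix.submatrix_apply]
  rw [← Equiv.sum_comp e]
  exact Finset.sum_congr rfl fun i _ => Equiv.sum_comp e fun j => star (X (e i) j) * Y (e i) j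

theorem inner_kronecker {I J : Type} [Fintype I] [Fintype J] (A C : Matrix I I ℂ)
    (B D : Matrix J J ℂ) : inner ℂ (A ⊗ₖ B) (C ⊗ₖ D) = inner ℂ A C * inner ℂ B D := by
  rw [inner_eq_trace, inner_eq_trace, inner_eq_trace, Matrix.conjTranspose_kronecker,
    ← Matrix.mul_kronecker_mul, Matrix.trace_kronecker]

theorem inner_permOp {ι : Type} [Fintype ι] [DecidableEq ι] {K : ℕ} (σ τ : Perm (Fin K)) :
    inner ℂ (permOp ι σ) (permOp ι τ) = (fixCount ι (σ * τ⁻¹) : ℂ) := by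
  rw [inner_eq_sum, Finset.sum_comm, fixCount, Nat.cast_sum]
  refine Finset.sum_congr rfl fun j _ => ?_
  rw [Finset.sum_eq_single (j ∘ τ)]
  · have : j ∘ τ = j ∘ σ ↔ j ∘ (σ * τ⁻¹ : Perm (Fin K)) = j := by
      constructor
      · intro h
        rw [Perm.coe_mul, ← Function.comp_assoc, ← h, Function.comp_assoc, ← Perm.coe_mul]
        simp
      · intro h
        conv_lhs => rw [← h]
        rw [Function.comp_assoc, ← Perm.coe_mul]
        simp
    simp only [permOp, Matrix.of_apply, this]
    split_ifs <;> simp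
  · intro b _ hb
    simp [permOp, hb]
  · simp

end Inner

section PermTensor

variable {P K : ℕ} (ι : Fin P → Type) [∀ p, Fintype (ι p)] [∀ p, DecidableEq (ι p)]

/-- The tensor product of the permutation operators `σ p` on the systems `ι p`. -/
def permTensor (σ : Fin P → Perm (Fin K)) :
    Matrix (Fin K → ∀ p, ι p) (Fin K → ∀ p, ι p) ℂ :=
  Matrix.of fun i j => ∏ p, permOp (ι p) (σ p) (fun k => i k p) (fun k => j k p)

omit [∀ p, Fintype (ι p)] in
theorem permTensor_const (π : Perm (Fin K)) :
    permTensor ι (fun _ => π) = permOp (∀ p, ι p) π := by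
  ext i j
  simp only [permTensor, permOp, Matrix.of_apply, Finset.prod_ite_zero, Finset.prod_const_one,
    Finset.mem_univ, forall_const]
  refine if_congr ?_ rfl rfl
  simp only [funext_iff, Function.comp_apply]
  exact forall_comm

attribute [local instance] Matrix.frobeniusNormedAddCommGroup Matrix.frobeniusNormedSpace
  frobeniusInnerProductSpace

omit [∀ p, DecidableEq (ι p)] in
theorem inner_tensor (X Y : ∀ p, Matrix (Fin K → ι p) (Fin K → ι p) ℂ) :
    inner ℂ (Matrix.of fun i j : Fin K → ∀ p, ι p =>
        ∏ p, X p (fun k => i k p) (fun k => j k p))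
      (Matrix.of fun i j : Fin K → ∀ p, ι p => ∏ p, Y p (fun k => i k p) (fun k => j k p)) =
      ∏ p, inner ℂ (X p) (Y p) := by
  simp only [inner_eq_sum, Matrix.of_apply, star_prod, ← Finset.prod_mul_distrib]
  simp only [← Fintype.sum_prod_type']
  rw [Finset.prod_univ_sum, Fintype.piFinset_univ]
  let e : ((Fin K → ∀ p, ι p) × (Fin K → ∀ p, ι p)) ≃
      (∀ p, (Fin K → ι p) × (Fin K → ι p)) :=
    { toFun := fun ab p => (fun k => ab.1 k p, fun k => ab.2 k p)
      invFun := fun f => (fun k p => (f p).1 k, fun k p => (f p).2 k)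
      left_inv := fun _ => rfl
      right_inv := fun _ => rfl }
  exact Fintype.sum_equiv e _ _ fun ab => rfl

/-- The Gram matrix is a convolution kernel on the group S_K^P, so all its row and column sums
coincide; the Schur test relies on this. -/
theorem inner_permTensor [∀ p, Nonempty (ι p)] (σ τ : Fin P → Perm (Fin K)) :
    inner ℂ (permTensor ι σ) (permTensor ι τ) =
      (((∏ p, (Fintype.card (ι p) : ℝ) ^ K) * fixRatioProd ι (σ * τ⁻¹) : ℝ) : ℂ) := by
  have h := inner_tensor ι (fun p => permOp (ι p) (σ p)) (fun p => permOp (ι p) (τ p))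
  refine h.trans ?_
  rw [fixRatioProd, ← Finset.prod_mul_distrib]
  push_cast
  refine Finset.prod_congr rfl fun p _ => ?_
  have hn : (Fintype.card (ι p) : ℂ) ≠ 0 := by exact_mod_cast Fintype.card_ne_zero
  rw [inner_permOp, fixRatio]
  push_cast
  rw [mul_div_cancel₀ _ (pow_ne_zero _ hn)]
  rfl

end PermTensor

/-! ### Tensor products of projections. -/

section TensorMap

variable {P K : ℕ} {ι : Fin P → Type} [∀ p, Fintype (ι p)] [∀ p, DecidableEq (ι p)]
  (T : ∀ p, Matrix (Fin K → ι p) (Fin K → ι p) ℂ →ₗ[ℂ] Matrix (Fin K → ι p) (Fin K → ι p) ℂ)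

attribute [local instance] Matrix.frobeniusNormedAddCommGroup Matrix.frobeniusNormedSpace
  frobeniusInnerProductSpace

theorem inner_single_left {J : Type} [Fintype J] [DecidableEq J] (i j : J) (X : Matrix J J ℂ) :
    inner ℂ (Matrix.single i j 1) X = X i j := by
  rw [inner_eq_sum, Finset.sum_eq_single i, Finset.sum_eq_single j]
  · simp
  · intro b _ hb
    simp [hb.symm]
  · simp
  · intro a _ ha
    simp [ha.symm]
  · simp

/-- In the orthonormal basis of matrix units the kernel of the tensor product is the product of the
Hermitian kernels of the factors. -/
theorem tensorMap_isSymmetric (hT : ∀ p, (T p).IsSymmetric) : (tensorMap T).IsSymmetric := by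
  have hk : ∀ p a b i j, star (T p (Matrix.single a b 1) i j) = T p (Matrix.single i j 1) a b := by
    intro p a b i j
    calc star (T p (Matrix.single a b 1) i j)
        = star (inner ℂ (Matrix.single i j 1) (T p (Matrix.single a b 1))) := by
          rw [inner_single_left]
      _ = inner ℂ (T p (Matrix.single a b 1)) (Matrix.single i j 1) := inner_conj_symm _ _
      _ = inner ℂ (Matrix.single a b 1) (T p (Matrix.single i j 1)) := hT p _ _
      _ = _ := inner_single_left _ _ _
  intro X Y
  simp only [inner_eq_sum, tensorMap, LinearMap.coe_mk, AddHom.coe_mk, Matrix.of_apply, star_sum,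
    star_mul', star_prod, hk, Finset.sum_mul, Finset.mul_sum]
  have h4 : ∀ f : (Fin K → ∀ p, ι p) → (Fin K → ∀ p, ι p) → (Fin K → ∀ p, ι p) →
      (Fin K → ∀ p, ι p) → ℂ, ∑ i, ∑ j, ∑ a, ∑ b, f i j a b = ∑ a, ∑ b, ∑ i, ∑ j, f i j a b := by
    intro f
    simp only [← Fintype.sum_prod_type']
    exact Fintype.sum_equiv ⟨fun x => (x.2.2.1, x.2.2.2, x.1, x.2.1),
      fun x => (x.2.2.1, x.2.2.2, x.1, x.2.1), fun _ => rfl, fun _ => rfl⟩ _ _ fun _ => rfl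
  rw [h4]
  refine Finset.sum_congr rfl fun a _ => Finset.sum_congr rfl fun b _ =>
    Finset.sum_congr rfl fun i _ => Finset.sum_congr rfl fun j _ => ?_
  ring

theorem tensorMap_permTensor (hT : ∀ p σ, T p (permOp (ι p) σ) = permOp (ι p) σ)
    (σ : Fin P → Perm (Fin K)) : tensorMap T (permTensor ι σ) = permTensor ι σ := by
  have := tensorMap_apply_tensor T fun p => permOp (ι p) (σ p)
  simp only [hT] at this
  exact this

theorem exists_tensorMap_eq_sum_permTensor
    (hT : ∀ p X, ∃ c : Perm (Fin K) → ℂ, T p X = ∑ σ, c σ • permOp (ι p) σ)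
    (X : Matrix (Fin K → ∀ p, ι p) (Fin K → ∀ p, ι p) ℂ) :
    ∃ c : (Fin P → Perm (Fin K)) → ℂ, tensorMap T X = ∑ σ, c σ • permTensor ι σ := by
  choose c hc using hT
  refine ⟨fun σ => ∑ a, ∑ b,
    (∏ p, c p (Matrix.single (fun k => a k p) (fun k => b k p) 1) (σ p)) * X a b, ?_⟩
  ext i j
  simp only [tensorMap, LinearMap.coe_mk, AddHom.coe_mk, Matrix.of_apply, Matrix.sum_apply,
    Matrix.smul_apply, smul_eq_mul, Finset.sum_mul]
  rw [eq_comm, Finset.sum_comm]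
  refine Finset.sum_congr rfl fun a _ => ?_
  rw [Finset.sum_comm]
  refine Finset.sum_congr rfl fun b _ => ?_
  have h : ∀ p, T p (Matrix.single (fun k => a k p) (fun k => b k p) 1)
      (fun k => i k p) (fun k => j k p) =
      ∑ σ, c p (Matrix.single (fun k => a k p) (fun k => b k p) 1) σ *
        permOp (ι p) σ (fun k => i k p) (fun k => j k p) := by
    intro p
    conv_lhs => rw [hc]
    simp [Matrix.sum_apply]
  simp only [h]
  rw [eq_comm, Finset.prod_univ_sum, Fintype.piFinset_univ, Finset.sum_mul]
  refine Finset.sum_congr rfl fun σ _ => ?_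
  rw [Finset.prod_mul_distrib]
  simp only [permTensor, Matrix.of_apply]
  ring

end TensorMap

/-! ### Unitaries acting on one factor of a bipartite system. -/

section Local

variable {κ μ ι : Type} [Fintype κ] [DecidableEq κ] [Fintype μ] [DecidableEq μ] [Fintype ι]
  [DecidableEq ι] {K : ℕ}

/-- The splitting of `K` copies of a system into `K` copies of each of two subsystems. -/
def splitCopies (K : ℕ) (e : ι ≃ κ × μ) : (Fin K → ι) ≃ (Fin K → κ) × (Fin K → μ) :=
  (Equiv.arrowCongr (Equiv.refl _) e).trans
    (Equiv.arrowProdEquivProdArrow (Fin K) (fun _ => κ) (fun _ => μ))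

omit [Fintype κ] [DecidableEq κ] [Fintype μ] [Fintype ι] [DecidableEq ι] in
theorem tensorPower_kronecker_one (e : ι ≃ κ × μ) (U : Matrix κ κ ℂ) :
    tensorPower K ((U ⊗ₖ (1 : Matrix μ μ ℂ)).submatrix e e) =
      (tensorPower K U ⊗ₖ (1 : Matrix (Fin K → μ) (Fin K → μ) ℂ)).submatrix
        (splitCopies K e) (splitCopies K e) := by
  ext i j
  rw [← tensorPower_one]
  simp only [tensorPower, Matrix.of_apply, Matrix.submatrix_apply, Matrix.kroneckerMap_apply,
    Finset.prod_mul_distrib]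
  rfl

theorem haarAverage_kronecker (e : ι ≃ κ × μ) (V : C(Matrix.unitaryGroup κ ℂ, Matrix ι ι ℂ))
    (hV : ∀ U, V U = ((U : Matrix κ κ ℂ) ⊗ₖ (1 : Matrix μ μ ℂ)).submatrix e e)
    (A : Matrix (Fin K → κ) (Fin K → κ) ℂ) (B : Matrix (Fin K → μ) (Fin K → μ) ℂ) :
    haarAverage K V ((A ⊗ₖ B).submatrix (splitCopies K e) (splitCopies K e)) =
      (twirl K κ A ⊗ₖ B).submatrix (splitCopies K e) (splitCopies K e) := by
  ext i j
  simp only [haarAverage, twirl, LinearMap.coe_mk, AddHom.coe_mk, Matrix.of_apply, hV,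
    tensorPower_kronecker_one, Matrix.conjTranspose_submatrix, Matrix.submatrix_mul_equiv,
    Matrix.conjTranspose_kronecker, ← Matrix.mul_kronecker_mul, Matrix.conjTranspose_one,
    Matrix.one_mul, Matrix.mul_one, Matrix.submatrix_apply, Matrix.kroneckerMap_apply]
  exact MeasureTheory.integral_mul_const _ _

omit [Fintype κ] [Fintype μ] [Fintype ι] in
theorem permOp_eq_kronecker (e : ι ≃ κ × μ) (σ : Perm (Fin K)) (i j : Fin K → ι) :
    permOp ι σ i j = permOp κ σ (fun k => (e (i k)).1) (fun k => (e (j k)).1) *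
      permOp μ σ (fun k => (e (i k)).2) (fun k => (e (j k)).2) := by
  simp only [permOp, Matrix.of_apply, ite_zero_mul_ite_zero, mul_one]
  refine if_congr ?_ rfl rfl
  simp only [funext_iff, Function.comp_apply, ← forall_and, ← Prod.ext_iff, e.injective.eq_iff]

end Local

/-! ### The crosstwirl: factorization and projection properties. -/

section Crosstwirl

variable {q P : ℕ} {ℓ m : Fin P → ℕ}

/-- The splitting of a block into its first `a` qudits and the others. -/
def splitBlock (q : ℕ) {a b : ℕ} (h : a ≤ b) : Block q b ≃ Block q a × Block q (b - a) where
  toFun i := (fun s => i (Fin.castLE h s), fun s => i ⟨a + s, by omega⟩)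
  invFun x s := if hs : (s : ℕ) < a then x.1 ⟨s, hs⟩ else x.2 ⟨s - a, by omega⟩
  left_inv i := by
    funext s
    by_cases hs : (s : ℕ) < a
    · simp [hs]
    · simp only [hs, dite_false]
      congr 1
      ext
      simp
      omega
  right_inv x := by
    ext s
    · simp
    · simp

/-- The splitting of the joint system into the first `ℓ p` qudits of all blocks and the others. -/
def splitBlocks (q : ℕ) {P : ℕ} {ℓ m : Fin P → ℕ} (h : ∀ p, ℓ p ≤ m p) :
    Blocks q m ≃ Blocks q ℓ × Blocks q (fun p => m p - ℓ p) :=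
  (Equiv.piCongrRight fun p => splitBlock q (h p)).trans (Equiv.arrowProdEquivProdArrow _ _ _)

theorem onFirstQudits_eq (h : ∀ p, ℓ p ≤ m p) (U : Matrix (Blocks q ℓ) (Blocks q ℓ) ℂ) :
    onFirstQudits h U = (U ⊗ₖ (1 : Matrix (Blocks q fun p => m p - ℓ p) _ ℂ)).submatrix
      (splitBlocks q h) (splitBlocks q h) := by
  ext i j
  simp only [onFirstQudits, Matrix.of_apply, Matrix.submatrix_apply, Matrix.kroneckerMap_apply,
    Matrix.one_apply]
  congr 1
  refine if_congr ?_ rfl rfl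
  simp only [funext_iff]
  refine forall_congr' fun p => ⟨fun hp s => hp _ (Nat.le_add_right _ _), fun hp s hs => ?_⟩
  have := hp ⟨s - ℓ p, by omega⟩
  have he : (⟨ℓ p + (s - ℓ p), by omega⟩ : Fin (m p)) = s := by
    ext
    simp
    omega
  change i p ⟨ℓ p + (s - ℓ p), _⟩ = j p ⟨ℓ p + (s - ℓ p), _⟩ at this
  rwa [he] at this

theorem permTensor_eq_kronecker {K : ℕ} (h : ∀ p, ℓ p ≤ m p) (σ : Fin P → Perm (Fin K)) :
    permTensor (fun p => Block q (m p)) σ =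
      (permTensor (fun p => Block q (ℓ p)) σ ⊗ₖ
        permTensor (fun p => Block q (m p - ℓ p)) σ).submatrix
        (splitCopies K (splitBlocks q h)) (splitCopies K (splitBlocks q h)) := by
  ext i j
  simp only [permTensor, Matrix.of_apply, Matrix.submatrix_apply, Matrix.kroneckerMap_apply,
    ← Finset.prod_mul_distrib]
  exact Finset.prod_congr rfl fun p _ => permOp_eq_kronecker (splitBlock q (h p)) _ _ _

theorem crosstwirl_permTensor {K : ℕ} (h : ∀ p, ℓ p ≤ m p) (σ : Fin P → Perm (Fin K)) :
    crosstwirl K q h (permTensor (fun p => Block q (m p)) σ) =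
      (twirl K (Blocks q ℓ) (permTensor (fun p => Block q (ℓ p)) σ) ⊗ₖ
        permTensor (fun p => Block q (m p - ℓ p)) σ).submatrix
        (splitCopies K (splitBlocks q h)) (splitCopies K (splitBlocks q h)) := by
  rw [permTensor_eq_kronecker h]
  exact haarAverage_kronecker (splitBlocks q h) _ (fun U => onFirstQudits_eq h _) _ _

attribute [local instance] Matrix.frobeniusNormedAddCommGroup Matrix.frobeniusNormedSpace
  frobeniusInnerProductSpace

/-- Permutation operators factor along any splitting of the system, and the crosstwirl acts only on
the first qudits. The two factors supply the diagonal and off-diagonal decay, respectively. -/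
theorem inner_crosstwirl_permTensor {K : ℕ} (h : ∀ p, ℓ p ≤ m p) (σ τ : Fin P → Perm (Fin K)) :
    inner ℂ (permTensor (fun p => Block q (m p)) σ)
        (crosstwirl K q h (permTensor (fun p => Block q (m p)) τ)) =
      inner ℂ (permTensor (fun p => Block q (ℓ p)) σ)
        (twirl K (Blocks q ℓ) (permTensor (fun p => Block q (ℓ p)) τ)) *
      inner ℂ (permTensor (fun p => Block q (m p - ℓ p)) σ)
        (permTensor (fun p => Block q (m p - ℓ p)) τ) := by
  rw [crosstwirl_permTensor, permTensor_eq_kronecker h σ, inner_submatrix_equiv, inner_kronecker]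

theorem onFirstQudits_mul (h : ∀ p, ℓ p ≤ m p) (U W : Matrix (Blocks q ℓ) (Blocks q ℓ) ℂ) :
    onFirstQudits h (U * W) = onFirstQudits h U * onFirstQudits h W := by
  rw [onFirstQudits_eq, onFirstQudits_eq, onFirstQudits_eq, Matrix.submatrix_mul_equiv,
    ← Matrix.mul_kronecker_mul, Matrix.one_mul]

theorem onFirstQudits_one (h : ∀ p, ℓ p ≤ m p) :
    onFirstQudits h (1 : Matrix (Blocks q ℓ) (Blocks q ℓ) ℂ) = 1 := by
  rw [onFirstQudits_eq, Matrix.one_kronecker_one, Matrix.submatrix_one_equiv]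

theorem onFirstQudits_conjTranspose (h : ∀ p, ℓ p ≤ m p)
    (U : Matrix (Blocks q ℓ) (Blocks q ℓ) ℂ) : onFirstQudits h Uᴴ = (onFirstQudits h U)ᴴ := by
  rw [onFirstQudits_eq, onFirstQudits_eq, Matrix.conjTranspose_submatrix,
    Matrix.conjTranspose_kronecker, Matrix.conjTranspose_one]

/-- The action of the joint unitaries on the whole system. -/
def crossAction (q : ℕ) {P : ℕ} {ℓ m : Fin P → ℕ} (h : ∀ p, ℓ p ≤ m p) :
    C(Matrix.unitaryGroup (Blocks q ℓ) ℂ, Matrix (Blocks q m) (Blocks q m) ℂ) :=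
  ⟨fun U => onFirstQudits h (U : Matrix (Blocks q ℓ) (Blocks q ℓ) ℂ),
    continuous_matrix fun _ _ =>
      (continuous_subtype_val.matrix_elem _ _).mul continuous_const⟩

theorem crosstwirl_eq_haarAverage (K : ℕ) (h : ∀ p, ℓ p ≤ m p) :
    crosstwirl K q h = haarAverage K (crossAction q h) := rfl

theorem crossAction_mul (h : ∀ p, ℓ p ≤ m p) (U W : Matrix.unitaryGroup (Blocks q ℓ) ℂ) :
    crossAction q h (U * W) = crossAction q h U * crossAction q h W :=
  onFirstQudits_mul h _ _

theorem crossAction_inv (h : ∀ p, ℓ p ≤ m p) (U : Matrix.unitaryGroup (Blocks q ℓ) ℂ) :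
    crossAction q h U⁻¹ = (crossAction q h U)ᴴ :=
  onFirstQudits_conjTranspose h _

theorem crossAction_one (h : ∀ p, ℓ p ≤ m p) : crossAction q h 1 = 1 :=
  onFirstQudits_one h

theorem crosstwirl_isSymmetric (K : ℕ) (h : ∀ p, ℓ p ≤ m p) : (crosstwirl K q h).IsSymmetric := by
  rw [crosstwirl_eq_haarAverage]
  exact haarAverage_isSymmetric _ (crossAction_inv h)

theorem crosstwirl_eq_self {K : ℕ} (h : ∀ p, ℓ p ≤ m p)
    {X : Matrix (Fin K → Blocks q m) (Fin K → Blocks q m) ℂ}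
    (hX : ∀ U, Commute X (tensorPower K (crossAction q h U))) : crosstwirl K q h X = X := by
  rw [crosstwirl_eq_haarAverage]
  refine haarAverage_eq_self _ (fun U => ?_) hX
  rw [← crossAction_inv, ← crossAction_mul, mul_inv_cancel, crossAction_one]

theorem crosstwirl_idem {K : ℕ} (h : ∀ p, ℓ p ≤ m p)
    (X : Matrix (Fin K → Blocks q m) (Fin K → Blocks q m) ℂ) :
    crosstwirl K q h (crosstwirl K q h X) = crosstwirl K q h X := by
  refine crosstwirl_eq_self h fun W => ?_
  rw [crosstwirl_eq_haarAverage]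
  refine haarAverage_commute _ (crossAction_mul h) (fun U => ?_) X W
  rw [← crossAction_inv, ← crossAction_mul, inv_mul_cancel, crossAction_one]

end Crosstwirl

/-! ### The Schur test. -/

section Schur

/-- The Schur test for a quadratic form on a finite group whose kernel is dominated by a
convolution kernel off the diagonal. -/
theorem schur_test {Ω : Type} [Group Ω] [Fintype Ω] [DecidableEq Ω] {β : Ω → ℝ} {ε N t : ℝ}
    (hβ : ∀ σ, 0 ≤ β σ) (h1 : β 1 = 1) (hs : ∑ σ, β σ ≤ 1 + ε) (hN : 0 ≤ N) (ht : 0 ≤ t)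
    (c : Ω → ℂ) (M : Ω → Ω → ℂ) (hdiag : ∀ σ, c σ ≠ 0 → ‖M σ σ‖ ≤ t)
    (hoff : ∀ σ τ, σ ≠ τ → ‖M σ τ‖ ≤ N * β (σ * τ⁻¹)) :
    ‖∑ σ, ∑ τ, star (c σ) * c τ * M σ τ‖ ≤ (N * ε + t) * ∑ σ, ‖c σ‖ ^ 2 := by
  -- The majorant has t on the diagonal in place of N β(1) = N, so its row and column sums are at
  -- most N(1 + ε) - N + t.
  let b : Ω → Ω → ℝ := fun σ τ => N * β (σ * τ⁻¹) + if σ = τ then t - N else 0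
  have hbd : ∀ σ, b σ σ = t := fun σ => by simp [b, h1]
  have hbo : ∀ σ τ, σ ≠ τ → b σ τ = N * β (σ * τ⁻¹) := fun σ τ h => by simp [b, h]
  have hb0 : ∀ σ τ, 0 ≤ b σ τ := by
    intro σ τ
    by_cases h : σ = τ
    · subst h; rw [hbd]; exact ht
    · rw [hbo _ _ h]; exact mul_nonneg hN (hβ _)
  have hNs : N * ∑ σ, β σ ≤ N * (1 + ε) := mul_le_mul_of_nonneg_left hs hN
  have hrow : ∀ σ, ∑ τ, b σ τ ≤ N * ε + t := by
    intro σ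
    have : ∑ τ, β (σ * τ⁻¹) = ∑ τ, β τ :=
      Fintype.sum_equiv ((Equiv.inv Ω).trans (Equiv.mulLeft σ)) _ _ fun _ => rfl
    simp only [b, Finset.sum_add_distrib, ← Finset.mul_sum, this, Finset.sum_ite_eq,
      Finset.mem_univ, if_true]
    linarith
  have hcol : ∀ τ, ∑ σ, b σ τ ≤ N * ε + t := by
    intro τ
    have : ∑ σ, β (σ * τ⁻¹) = ∑ σ, β σ :=
      Fintype.sum_equiv (Equiv.mulRight τ⁻¹) _ _ fun _ => rfl
    simp only [b, Finset.sum_add_distrib, ← Finset.mul_sum, this, Finset.sum_ite_eq',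
      Finset.mem_univ, if_true]
    linarith
  have hterm : ∀ σ τ, ‖star (c σ) * c τ * M σ τ‖ ≤
      (‖c σ‖ ^ 2 * b σ τ + ‖c τ‖ ^ 2 * b σ τ) / 2 := by
    intro σ τ
    rw [norm_mul, norm_mul, norm_star]
    have h2 : ‖c σ‖ * ‖c τ‖ * ‖M σ τ‖ ≤ ‖c σ‖ * ‖c τ‖ * b σ τ := by
      by_cases h : σ = τ
      · subst h
        by_cases hc : c σ = 0
        · simp [hc]
        · rw [hbd]
          exact mul_le_mul_of_nonneg_left (hdiag σ hc) (by positivity)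
      · rw [hbo _ _ h]
        exact mul_le_mul_of_nonneg_left (hoff σ τ h) (by positivity)
    have h3 := mul_nonneg (sq_nonneg (‖c σ‖ - ‖c τ‖)) (hb0 σ τ)
    nlinarith
  have hA : ∑ σ, ∑ τ, ‖c σ‖ ^ 2 * b σ τ ≤ (N * ε + t) * ∑ σ, ‖c σ‖ ^ 2 := by
    rw [Finset.mul_sum]
    refine Finset.sum_le_sum fun σ _ => ?_
    rw [← Finset.mul_sum, mul_comm]
    exact mul_le_mul_of_nonneg_right (hrow σ) (by positivity)
  have hB : ∑ σ, ∑ τ, ‖c τ‖ ^ 2 * b σ τ ≤ (N * ε + t) * ∑ σ, ‖c σ‖ ^ 2 := by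
    rw [Finset.sum_comm, Finset.mul_sum]
    refine Finset.sum_le_sum fun τ _ => ?_
    rw [← Finset.mul_sum, mul_comm]
    exact mul_le_mul_of_nonneg_right (hcol τ) (by positivity)
  calc ‖∑ σ, ∑ τ, star (c σ) * c τ * M σ τ‖
      ≤ ∑ σ, ∑ τ, (‖c σ‖ ^ 2 * b σ τ + ‖c τ‖ ^ 2 * b σ τ) / 2 :=
        (norm_sum_le _ _).trans (Finset.sum_le_sum fun σ _ =>
          (norm_sum_le _ _).trans (Finset.sum_le_sum fun τ _ => hterm σ τ))
    _ = (∑ σ, ∑ τ, ‖c σ‖ ^ 2 * b σ τ + ∑ σ, ∑ τ, ‖c τ‖ ^ 2 * b σ τ) / 2 := by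
        simp only [← Finset.sum_div, Finset.sum_add_distrib]
    _ ≤ _ := by linarith

end Schur

/-! ### Projections and nearly orthogonal families in an inner product space. -/

section Hilbert

variable {E : Type} [NormedAddCommGroup E] [InnerProductSpace ℂ E]

theorem inner_sum_smul {Ω : Type} [Fintype Ω] (c : Ω → ℂ) (v w : Ω → E) :
    inner ℂ (∑ σ, c σ • v σ) (∑ σ, c σ • w σ) =
      ∑ σ, ∑ τ, star (c σ) * c τ * inner ℂ (v σ) (w τ) := by
  rw [sum_inner]
  refine Finset.sum_congr rfl fun σ _ => ?_
  rw [inner_sum]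
  refine Finset.sum_congr rfl fun τ _ => ?_
  rw [inner_smul_left, inner_smul_right, starRingEnd_apply, mul_assoc]

/-- Vectors whose Gram matrix is close to a multiple of the identity are well conditioned. -/
theorem le_norm_sq_sum_smul {Ω : Type} [Group Ω] [Fintype Ω] [DecidableEq Ω] {β : Ω → ℝ}
    {ε N : ℝ} (hβ : ∀ σ, 0 ≤ β σ) (h1 : β 1 = 1) (hs : ∑ σ, β σ ≤ 1 + ε) (hN : 0 ≤ N)
    (v : Ω → E) (hv : ∀ σ τ, inner ℂ (v σ) (v τ) = ((N * β (σ * τ⁻¹) : ℝ) : ℂ)) (c : Ω → ℂ) :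
    N * (1 - ε) * ∑ σ, ‖c σ‖ ^ 2 ≤ ‖∑ σ, c σ • v σ‖ ^ 2 := by
  -- Applied to the Gram matrix minus N times the identity, whose diagonal vanishes; hence t = 0.
  have h := schur_test hβ h1 hs hN le_rfl c
    (fun σ τ => inner ℂ (v σ) (v τ) - if σ = τ then (N : ℂ) else 0)
    (fun σ _ => by rw [hv]; simp [h1])
    (fun σ τ hστ => by
      simp only [hστ, if_false, sub_zero, hv, Complex.norm_real, Real.norm_eq_abs]
      rw [abs_of_nonneg (mul_nonneg hN (hβ _))])
  have he : ∑ σ, ∑ τ, star (c σ) * c τ *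
      (inner ℂ (v σ) (v τ) - if σ = τ then (N : ℂ) else 0) =
      inner ℂ (∑ σ, c σ • v σ) (∑ σ, c σ • v σ) - ((N * ∑ σ, ‖c σ‖ ^ 2 : ℝ) : ℂ) := by
    rw [inner_sum_smul]
    simp only [mul_sub, Finset.sum_sub_distrib, mul_ite, mul_zero, Finset.sum_ite_eq,
      Finset.mem_univ, if_true]
    congr 1
    push_cast
    rw [Finset.mul_sum]
    refine Finset.sum_congr rfl fun σ _ => ?_
    rw [Complex.star_def, Complex.conj_mul', mul_comm]
  rw [he, inner_self_eq_norm_sq_to_K] at h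
  have h2 : (‖∑ σ, c σ • v σ‖ : ℂ) ^ 2 - ((N * ∑ σ, ‖c σ‖ ^ 2 : ℝ) : ℂ) =
      ((‖∑ σ, c σ • v σ‖ ^ 2 - N * ∑ σ, ‖c σ‖ ^ 2 : ℝ) : ℂ) := by push_cast; rfl
  have h3 : ‖((‖∑ σ, c σ • v σ‖ ^ 2 - N * ∑ σ, ‖c σ‖ ^ 2 : ℝ) : ℂ)‖ ≤
      (N * ε + 0) * ∑ σ, ‖c σ‖ ^ 2 := by
    rw [← h2]; exact h
  rw [Complex.norm_real, Real.norm_eq_abs] at h3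
  have := (abs_le.mp h3).1
  nlinarith

theorem norm_sq_eq_re_inner_of_isSymmetric {Q : E →ₗ[ℂ] E} (hQ : Q.IsSymmetric)
    (hQQ : ∀ X, Q (Q X) = Q X) (X : E) : ((‖Q X‖ ^ 2 : ℝ) : ℂ) = inner ℂ X (Q X) := by
  rw [← hQQ X, ← hQ X, hQQ X, inner_self_eq_norm_sq_to_K]
  push_cast
  rfl

theorem norm_apply_le_of_isSymmetric {Q : E →ₗ[ℂ] E} (hQ : Q.IsSymmetric)
    (hQQ : ∀ X, Q (Q X) = Q X) (X : E) : ‖Q X‖ ≤ ‖X‖ := by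
  have h := norm_inner_le_norm (𝕜 := ℂ) X (Q X)
  rw [← norm_sq_eq_re_inner_of_isSymmetric hQ hQQ, Complex.norm_real, Real.norm_eq_abs,
    abs_of_nonneg (by positivity)] at h
  by_contra! hc
  nlinarith [norm_nonneg X]

/-- Bessel's inequality for the orthogonal projection onto the span of nearly orthogonal
vectors. -/
theorem mul_norm_sq_proj_le {Ω : Type} [Group Ω] [Fintype Ω] [DecidableEq Ω] {β : Ω → ℝ}
    {ε N : ℝ} (hβ : ∀ σ, 0 ≤ β σ) (h1 : β 1 = 1) (hs : ∑ σ, β σ ≤ 1 + ε) (hN : 0 ≤ N)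
    (hε : ε ≤ 1) (v : Ω → E) (hv : ∀ σ τ, inner ℂ (v σ) (v τ) = ((N * β (σ * τ⁻¹) : ℝ) : ℂ))
    {T : E →ₗ[ℂ] E} (hT : T.IsSymmetric) (hTT : ∀ X, T (T X) = T X) (w : E)
    (hw : ∃ c : Ω → ℂ, T w = ∑ σ, c σ • v σ) :
    N * (1 - ε) * ‖T w‖ ^ 2 ≤ ∑ σ, ‖(inner ℂ (v σ) w : ℂ)‖ ^ 2 := by
  obtain ⟨c, hc⟩ := hw
  have hlow := le_norm_sq_sum_smul hβ h1 hs hN v hv c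
  rw [← hc] at hlow
  -- ‖Tw‖² = ⟨Tw, w⟩, expanded in the v σ. Cauchy–Schwarz then combines with the lower bound for
  -- ‖Tw‖² in terms of the coefficients.
  have hin : ‖T w‖ ^ 2 ≤ ∑ σ, ‖c σ‖ * ‖(inner ℂ (v σ) w : ℂ)‖ := by
    have h := norm_sq_eq_re_inner_of_isSymmetric hT hTT w
    rw [← hT w w, hc, sum_inner] at h
    have h2 := congrArg norm h
    rw [Complex.norm_real, Real.norm_eq_abs, abs_of_nonneg (by positivity)] at h2
    rw [hc, h2]
    refine (norm_sum_le _ _).trans (Finset.sum_le_sum fun σ _ => ?_)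
    rw [inner_smul_left, norm_mul, RCLike.norm_conj]
  have hcs := Finset.sum_mul_sq_le_sq_mul_sq Finset.univ (fun σ => ‖c σ‖)
    fun σ => ‖(inner ℂ (v σ) w : ℂ)‖
  set u : ℝ := ‖T w‖ ^ 2
  set B : ℝ := ∑ σ, ‖(inner ℂ (v σ) w : ℂ)‖ ^ 2
  set S : ℝ := ∑ σ, ‖c σ‖ ^ 2
  have hu : 0 ≤ u := by positivity
  have hB : 0 ≤ B := by positivity
  have hk : 0 ≤ N * (1 - ε) := mul_nonneg hN (by linarith)
  have h4 : u ^ 2 ≤ S * B := (pow_le_pow_left₀ hu hin 2).trans hcs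
  rcases hu.eq_or_lt with h0 | h0
  · rw [← h0, mul_zero]; exact hB
  · have h5 : N * (1 - ε) * u * u ≤ B * u := by
      calc N * (1 - ε) * u * u = N * (1 - ε) * u ^ 2 := by ring
        _ ≤ N * (1 - ε) * (S * B) := mul_le_mul_of_nonneg_left h4 hk
        _ = (N * (1 - ε) * S) * B := by ring
        _ ≤ u * B := mul_le_mul_of_nonneg_right hlow hB
        _ = B * u := mul_comm _ _
    exact le_of_mul_le_mul_right h5 h0

/-- A projection is small on combinations of nearly orthogonal vectors that are orthogonal to those
vectors which it fixes, if it is small on each of the other vectors. -/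
theorem norm_sq_proj_sum_le {Ω : Type} [Group Ω] [Fintype Ω] [DecidableEq Ω] {β : Ω → ℝ}
    {ε N t : ℝ} (hβ : ∀ σ, 0 ≤ β σ) (h1 : β 1 = 1) (hs : ∑ σ, β σ ≤ 1 + ε) (hN : 0 ≤ N)
    (ht : 0 ≤ t) (v : Ω → E) {Q : E →ₗ[ℂ] E} (hQ : Q.IsSymmetric)
    (hQQ : ∀ X, Q (Q X) = Q X) (D : Ω → Prop) (hD : ∀ σ, D σ → Q (v σ) = v σ)
    (hdiag : ∀ σ, ¬ D σ → ‖(inner ℂ (v σ) (Q (v σ)) : ℂ)‖ ≤ t)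
    (hoff : ∀ σ τ, σ ≠ τ → ‖(inner ℂ (v σ) (Q (v τ)) : ℂ)‖ ≤ N * β (σ * τ⁻¹))
    (c : Ω → ℂ) (hX : ∀ σ, D σ → inner ℂ (v σ) (∑ τ, c τ • v τ) = (0 : ℂ)) :
    ‖Q (∑ σ, c σ • v σ)‖ ^ 2 ≤ (N * ε + t) * ∑ σ, ‖c σ‖ ^ 2 := by
  classical
  let c' : Ω → ℂ := fun σ => if D σ then 0 else c σ
  let c'' : Ω → ℂ := fun σ => if D σ then c σ else 0
  set X := ∑ σ, c σ • v σ with hXdef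
  set Y := ∑ σ, c' σ • v σ with hY
  set Z := ∑ σ, c'' σ • v σ with hZ
  have hXYZ : X = Z + Y := by
    rw [hXdef, hY, hZ, ← Finset.sum_add_distrib]
    refine Finset.sum_congr rfl fun σ _ => ?_
    by_cases h : D σ <;> simp [c', c'', h]
  have hQZ : Q Z = Z := by
    rw [hZ, map_sum]
    refine Finset.sum_congr rfl fun σ _ => ?_
    by_cases h : D σ
    · rw [map_smul, hD σ h]
    · simp [c'', h]
  have hZX : inner ℂ Z X = (0 : ℂ) := by
    rw [hZ, sum_inner]
    refine Finset.sum_eq_zero fun σ _ => ?_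
    by_cases h : D σ
    · rw [inner_smul_left, hX σ h, mul_zero]
    · simp [c'', h]
  have hXZ : inner ℂ X Z = (0 : ℂ) := by
    rw [← inner_conj_symm, hZX, map_zero]
  -- Z collects the terms fixed by Q and is orthogonal to X. Removing it leaves the form at Y minus
  -- ‖Z‖², so the large diagonal entries at fixed vectors never enter.
  have hmain : ((‖Q X‖ ^ 2 : ℝ) : ℂ) = inner ℂ Y (Q Y) - inner ℂ Z Z := by
    rw [norm_sq_eq_re_inner_of_isSymmetric hQ hQQ]
    have e1 : inner ℂ X (Q X) = (inner ℂ X (Q Y) : ℂ) := by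
      conv_lhs => rw [hXYZ, map_add, hQZ, ← hXYZ, inner_add_right, hXZ, zero_add]
    have e2 : inner ℂ X (Q Y) = (inner ℂ Z Y + inner ℂ Y (Q Y) : ℂ) := by
      rw [hXYZ, inner_add_left, ← hQ Z, hQZ]
    have e3 : inner ℂ Z Y = (- inner ℂ Z Z : ℂ) := by
      have := hZX
      rw [hXYZ, inner_add_right] at this
      exact eq_neg_of_add_eq_zero_right this
    rw [e1, e2, e3]; ring
  have hre := congrArg Complex.re hmain
  rw [Complex.ofReal_re, Complex.sub_re] at hre
  have hZ0 : 0 ≤ (inner ℂ Z Z : ℂ).re := inner_self_nonneg (𝕜 := ℂ)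
  have hYQ : (inner ℂ Y (Q Y) : ℂ).re ≤ (N * ε + t) * ∑ σ, ‖c' σ‖ ^ 2 := by
    refine (Complex.re_le_norm _).trans ?_
    have e : Q Y = ∑ σ, c' σ • Q (v σ) := by rw [hY, map_sum]; simp only [map_smul]
    rw [e, hY, inner_sum_smul]
    refine schur_test hβ h1 hs hN ht c' _ (fun σ hσ => hdiag σ fun h => hσ ?_) hoff
    simp [c', h]
  have hε : 0 ≤ ε := by
    have := Finset.single_le_sum (fun σ _ => hβ σ) (Finset.mem_univ (1 : Ω))
    rw [h1] at this
    linarith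
  have hcc : ∑ σ, ‖c' σ‖ ^ 2 ≤ ∑ σ, ‖c σ‖ ^ 2 := by
    refine Finset.sum_le_sum fun σ _ => ?_
    by_cases h : D σ <;> simp [c', h]
  have := mul_le_mul_of_nonneg_left hcc (show 0 ≤ N * ε + t by positivity)
  linarith

/-- The vector X = (PQ - R)Y satisfies PX = X and RX = 0, so ‖X‖² = ⟨X, QY⟩ = ⟨QX, Y⟩ ≤ η‖X‖‖Y‖. -/
theorem norm_comp_sub_le {P Q R : E →ₗ[ℂ] E} (hP : P.IsSymmetric) (hQ : Q.IsSymmetric)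
    (hR : R.IsSymmetric) (hPP : ∀ X, P (P X) = P X) (hRR : ∀ X, R (R X) = R X)
    (hPR : ∀ X, P (R X) = R X) (hQR : ∀ X, Q (R X) = R X) {η : ℝ}
    (hη : 0 ≤ η) (h : ∀ X, P X = X → R X = 0 → ‖Q X‖ ≤ η * ‖X‖) (Y : E) :
    ‖P (Q Y) - R Y‖ ≤ η * ‖Y‖ := by
  have hRP : ∀ X, R (P X) = R X := fun X => ext_inner_right ℂ fun Z => by
    rw [hR, hP, hPR, hR]
  have hRQ : ∀ X, R (Q X) = R X := fun X => ext_inner_right ℂ fun Z => by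
    rw [hR, hQ, hQR, hR]
  set X := P (Q Y) - R Y with hX
  have hPX : P X = X := by rw [hX, map_sub, hPP, hPR]
  have hRX : R X = 0 := by rw [hX, map_sub, hRP, hRQ, hRR, sub_self]
  have hin : ((‖X‖ ^ 2 : ℝ) : ℂ) = inner ℂ (Q X) Y := by
    have e1 : ((‖X‖ ^ 2 : ℝ) : ℂ) = inner ℂ X X := by
      rw [inner_self_eq_norm_sq_to_K]; push_cast; rfl
    have e2 : (inner ℂ X X : ℂ) = inner ℂ X (P (Q Y)) - inner ℂ X (R Y) := by
      rw [← inner_sub_right, ← hX]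
    rw [e1, e2, ← hP, ← hR, hPX, hRX, inner_zero_left, sub_zero, hQ]
  have h2 := congrArg norm hin
  rw [Complex.norm_real, Real.norm_eq_abs, abs_of_nonneg (by positivity)] at h2
  have h3 : ‖X‖ ^ 2 ≤ ‖Q X‖ * ‖Y‖ := h2 ▸ norm_inner_le_norm _ _
  have h4 := mul_le_mul_of_nonneg_right (h X hPX hRX) (norm_nonneg Y)
  rcases (norm_nonneg X).eq_or_lt with h0 | h0
  · rw [← h0]
    positivity
  · refine le_of_mul_le_mul_right (a := ‖X‖) ?_ h0
    nlinarith

end Hilbert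

/-! ### Numerical bounds on overlaps. -/

section Bounds

theorem fixRatioProd_le {P K : ℕ} (ι : Fin P → Type) [∀ p, Fintype (ι p)]
    [∀ p, DecidableEq (ι p)] (σ : Fin P → Perm (Fin K)) (p : Fin P) :
    fixRatioProd ι σ ≤ fixRatio (ι p) (σ p) := by
  rw [fixRatioProd, ← Finset.mul_prod_erase _ _ (Finset.mem_univ p)]
  exact mul_le_of_le_one_right (fixRatio_nonneg _ _)
    (Finset.prod_le_one (fun _ _ => fixRatio_nonneg _ _) fun _ _ => fixRatio_le_one _ _)

/-- A permutation π differs from σ p or from σ p'; the factor at such a block bounds the product.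
Its square is the ratio for two copies of the block, of dimension q^(2ℓ) in the application, which
is where the exponent 2ℓ arises. -/
theorem sum_fixRatioProd_sq_le {P K : ℕ} (ι : Fin P → Type) [∀ p, Fintype (ι p)]
    [∀ p, DecidableEq (ι p)] [∀ p, Nonempty (ι p)] (σ : Fin P → Perm (Fin K)) {p p' : Fin P}
    (h : σ p ≠ σ p') :
    ∑ π : Perm (Fin K), fixRatioProd ι ((fun _ => π) * σ⁻¹) ^ 2 ≤
      (∑ π : Perm (Fin K), fixRatio (ι p × ι p) π - 1) +
        (∑ π : Perm (Fin K), fixRatio (ι p' × ι p') π - 1) := by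
  have key : ∀ s : Fin P, ∑ π : Perm (Fin K),
      (if π = σ s then 0 else fixRatio (ι s × ι s) (π * (σ s)⁻¹)) =
        ∑ π : Perm (Fin K), fixRatio (ι s × ι s) π - 1 := by
    intro s
    rw [← Equiv.sum_comp (Equiv.mulRight (σ s)⁻¹) (fun π => fixRatio (ι s × ι s) π),
      ← Finset.add_sum_erase Finset.univ _ (Finset.mem_univ (σ s)),
      ← Finset.add_sum_erase Finset.univ
        (fun π => fixRatio (ι s × ι s) (Equiv.mulRight (σ s)⁻¹ π)) (Finset.mem_univ (σ s))]
    simp only [if_true, Equiv.coe_mulRight, mul_inv_cancel, fixRatio_one]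
    rw [zero_add, add_sub_cancel_left]
    exact Finset.sum_congr rfl fun π hπ => if_neg (Finset.ne_of_mem_erase hπ)
  rw [← key p, ← key p', ← Finset.sum_add_distrib]
  refine Finset.sum_le_sum fun π _ => ?_
  have hsq : ∀ s, fixRatioProd ι ((fun _ => π) * σ⁻¹) ^ 2 ≤
      fixRatio (ι s × ι s) (π * (σ s)⁻¹) := by
    intro s
    rw [fixRatio_prod, ← sq]
    exact pow_le_pow_left₀ (fixRatioProd_nonneg _ _) (fixRatioProd_le ι _ s) 2
  by_cases hp : π = σ p
  · have hp' : π ≠ σ p' := fun h' => h (hp.symm.trans h')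
    rw [if_pos hp, if_neg hp', zero_add]
    exact hsq p'
  · rw [if_neg hp]
    refine (hsq p).trans (le_add_of_nonneg_right ?_)
    split_ifs
    · exact le_rfl
    · exact fixRatio_nonneg _ _

/-- From |e^u - 1| ≤ 2|u| at u = x/2; the half comes from the exponent K²/(2n). -/
theorem exp_le_one_add_of_le_half {x y : ℝ} (hx0 : 0 ≤ x) (hx1 : x ≤ 1) (hy : y ≤ x / 2) :
    Real.exp y ≤ 1 + x := by
  have h := Real.abs_exp_sub_one_le (x := x / 2) (by rw [abs_of_nonneg (by linarith)]; linarith)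
  rw [abs_of_nonneg (show (0 : ℝ) ≤ x / 2 by linarith)] at h
  have := Real.exp_le_exp.mpr hy
  linarith [(abs_le.mp h).2]

variable {q P K : ℕ} {ℓ : Fin P → ℕ} {x : ℝ}

theorem sum_fixRatioProd_block_le [NeZero q] {n : Fin P → ℕ} (hn : ∀ p, 2 * ℓ p ≤ n p)
    (hx : (K : ℝ) ^ 2 * ∑ p, 1 / (q : ℝ) ^ (2 * ℓ p) = x) (hx1 : x ≤ 1) :
    ∑ σ : Fin P → Perm (Fin K), fixRatioProd (fun p => Block q (n p)) σ ≤ 1 + x := by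
  have hq : (1 : ℝ) ≤ q := by exact_mod_cast NeZero.one_le
  have hx0 : 0 ≤ x := by rw [← hx]; positivity
  refine (sum_fixRatioProd_le _).trans (exp_le_one_add_of_le_half hx0 hx1 ?_)
  rw [← hx, Finset.mul_sum, Finset.sum_div]
  refine Finset.sum_le_sum fun p _ => ?_
  have h1 : (q : ℝ) ^ (2 * ℓ p) ≤ (q : ℝ) ^ n p := pow_le_pow_right₀ hq (hn p)
  have hc : (Fintype.card (Block q (n p)) : ℝ) = (q : ℝ) ^ n p := by simp
  rw [hc, mul_one_div, div_div, mul_comm _ (2 : ℝ)]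
  gcongr

theorem sum_fixRatio_block_prod_le [NeZero q]
    (hx : (K : ℝ) ^ 2 * ∑ p, 1 / (q : ℝ) ^ (2 * ℓ p) = x) (hx1 : x ≤ 1) (p : Fin P) :
    ∑ σ : Perm (Fin K), fixRatio (Block q (ℓ p) × Block q (ℓ p)) σ ≤ 1 + x := by
  have hq : (1 : ℝ) ≤ q := by exact_mod_cast NeZero.one_le
  have hx0 : 0 ≤ x := by rw [← hx]; positivity
  refine (sum_fixRatio_le _ _).trans (exp_le_one_add_of_le_half hx0 hx1 ?_)
  have hc : (Fintype.card (Block q (ℓ p) × Block q (ℓ p)) : ℝ) = (q : ℝ) ^ (2 * ℓ p) := by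
    simp; ring
  have h1 := Finset.single_le_sum (f := fun p => 1 / (q : ℝ) ^ (2 * ℓ p))
    (fun _ _ => by positivity) (Finset.mem_univ p)
  have h2 := mul_le_mul_of_nonneg_left h1 (sq_nonneg (K : ℝ))
  rw [hx] at h2
  rw [hc]
  calc (K : ℝ) ^ 2 / (2 * (q : ℝ) ^ (2 * ℓ p)) = ((K : ℝ) ^ 2 * (1 / (q : ℝ) ^ (2 * ℓ p))) / 2 := by
        field_simp
    _ ≤ x / 2 := by linarith

theorem sum_fixRatio_blocks_le [NeZero q]
    (hx : (K : ℝ) ^ 2 * ∑ p, 1 / (q : ℝ) ^ (2 * ℓ p) = x) (hx1 : x ≤ 1) {p p' : Fin P}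
    (hp : p ≠ p') : ∑ σ : Perm (Fin K), fixRatio (Blocks q ℓ) σ ≤ 1 + x := by
  have hq : (1 : ℝ) ≤ q := by exact_mod_cast NeZero.one_le
  have hx0 : 0 ≤ x := by rw [← hx]; positivity
  refine (sum_fixRatio_le _ _).trans (exp_le_one_add_of_le_half hx0 hx1 ?_)
  have hc : (Fintype.card (Blocks q ℓ) : ℝ) = ∏ s, (q : ℝ) ^ ℓ s := by simp
  have hprod : (q : ℝ) ^ ℓ p * (q : ℝ) ^ ℓ p' ≤ ∏ s, (q : ℝ) ^ ℓ s := by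
    have : q ^ ℓ p * q ^ ℓ p' ≤ ∏ s, q ^ ℓ s := by
      rw [← Finset.prod_pair (f := fun s => q ^ ℓ s) hp]
      exact Finset.prod_le_prod_of_subset_of_one_le' (Finset.subset_univ _)
        fun s _ _ => Nat.one_le_pow _ _ NeZero.one_le
    exact_mod_cast this
  have hsum : 1 / (q : ℝ) ^ (2 * ℓ p) + 1 / (q : ℝ) ^ (2 * ℓ p') ≤
      ∑ s, 1 / (q : ℝ) ^ (2 * ℓ s) := by
    rw [← Finset.sum_pair (f := fun s => 1 / (q : ℝ) ^ (2 * ℓ s)) hp]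
    exact Finset.sum_le_sum_of_subset_of_nonneg (Finset.subset_univ _)
      fun _ _ _ => by positivity
  have ha : (0 : ℝ) < 1 / (q : ℝ) ^ ℓ p := by positivity
  have hb : (0 : ℝ) < 1 / (q : ℝ) ^ ℓ p' := by positivity
  have h1 : 1 / (∏ s, (q : ℝ) ^ ℓ s) ≤ 1 / (q : ℝ) ^ ℓ p * (1 / (q : ℝ) ^ ℓ p') := by
    rw [one_div_mul_one_div]
    exact one_div_le_one_div_of_le (by positivity) hprod
  have h2 : ∀ s, 1 / (q : ℝ) ^ (2 * ℓ s) = (1 / (q : ℝ) ^ ℓ s) ^ 2 := by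
    intro s
    rw [one_div_pow, ← pow_mul, mul_comm]
  rw [h2, h2] at hsum
  have h3 : 1 / (∏ s, (q : ℝ) ^ ℓ s) ≤ ∑ s, 1 / (q : ℝ) ^ (2 * ℓ s) := by
    -- Two distinct blocks give q^(-L) ≤ ab ≤ a² + b² with a = q^(-ℓ p) and b = q^(-ℓ p').
    nlinarith [sq_nonneg (1 / (q : ℝ) ^ ℓ p - 1 / (q : ℝ) ^ ℓ p')]
  have h4 := mul_le_mul_of_nonneg_left h3 (sq_nonneg (K : ℝ))
  rw [hx] at h4
  have hpos : 0 < ∏ s, (q : ℝ) ^ ℓ s := Finset.prod_pos fun s _ => by positivity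
  rw [hc]
  calc (K : ℝ) ^ 2 / (2 * ∏ s, (q : ℝ) ^ ℓ s) = ((K : ℝ) ^ 2 * (1 / ∏ s, (q : ℝ) ^ ℓ s)) / 2 := by
        field_simp
    _ ≤ x / 2 := by linarith

end Bounds

/-! ### Assembly of the estimate. -/

section Main

attribute [local instance] Matrix.frobeniusNormedAddCommGroup Matrix.frobeniusNormedSpace
  frobeniusInnerProductSpace

variable {K q P : ℕ} {ℓ m : Fin P → ℕ} {x : ℝ}

theorem twirl_idem {ι : Type} [Fintype ι] [DecidableEq ι] (hK : K ≤ Fintype.card ι)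
    (X : Matrix (Fin K → ι) (Fin K → ι) ℂ) : twirl K ι (twirl K ι X) = twirl K ι X := by
  obtain ⟨c, hc⟩ := exists_twirl_eq_sum_permOp K ι hK X
  rw [hc, map_sum]
  simp only [map_smul, twirl_permOp]

/-- The twirl on the joint first qudits is small on tensor products of permutations that are not
all equal. -/
theorem norm_sq_twirl_permTensor_le [NeZero q] (hKL : K ≤ q ^ ∑ p, ℓ p)
    (hx : (K : ℝ) ^ 2 * ∑ p, 1 / (q : ℝ) ^ (2 * ℓ p) = x) (hx1 : x ≤ 1)
    (σ : Fin P → Perm (Fin K)) (hσ : ¬ ∃ π, σ = fun _ => π) :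
    (1 - x) * ‖twirl K (Blocks q ℓ) (permTensor (fun p => Block q (ℓ p)) σ)‖ ^ 2 ≤
      (∏ p, (Fintype.card (Block q (ℓ p)) : ℝ) ^ K) * (2 * x) := by
  obtain ⟨p, p', hpp⟩ : ∃ p p', σ p ≠ σ p' := by
    by_contra! hcon
    rcases isEmpty_or_nonempty (Fin P) with hP | ⟨⟨p₀⟩⟩
    -- With no blocks every family is vacuously constant.
    · exact hσ ⟨1, funext fun p => hP.elim p⟩
    · exact hσ ⟨σ p₀, funext fun p => hcon p p₀⟩
  have hne : p ≠ p' := fun h => hpp (by rw [h])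
  set N : ℝ := ∏ p, (Fintype.card (Block q (ℓ p)) : ℝ) ^ K with hN
  have hNpos : 0 < N := Finset.prod_pos fun p _ => by
    have : 0 < Fintype.card (Block q (ℓ p)) := Fintype.card_pos
    positivity
  have hcard : K ≤ Fintype.card (Blocks q ℓ) := by
    simpa [Finset.prod_pow_eq_pow_sum] using hKL
  have hcN : (Fintype.card (Blocks q ℓ) : ℝ) ^ K = N := by
    rw [hN, Finset.prod_pow, Fintype.card_pi]
    push_cast
    rfl
  have hv : ∀ π τ : Perm (Fin K), inner ℂ (permOp (Blocks q ℓ) π) (permOp (Blocks q ℓ) τ) =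
      ((N * fixRatio (Blocks q ℓ) (π * τ⁻¹) : ℝ) : ℂ) := by
    intro π τ
    rw [inner_permOp, fixRatio, hcN, mul_div_cancel₀ _ hNpos.ne']
    rfl
  have hb := mul_norm_sq_proj_le (fun π => fixRatio_nonneg (Blocks q ℓ) π)
    (fixRatio_one (Blocks q ℓ)) (sum_fixRatio_blocks_le hx hx1 hne) hNpos.le hx1
    (fun π => permOp (Blocks q ℓ) π) hv (twirl_isSymmetric K (Blocks q ℓ)) (twirl_idem hcard)
    (permTensor (fun p => Block q (ℓ p)) σ) (exists_twirl_eq_sum_permOp K _ hcard _)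
  have hin : ∀ π : Perm (Fin K),
      ‖(inner ℂ (permOp (Blocks q ℓ) π) (permTensor (fun p => Block q (ℓ p)) σ) : ℂ)‖ ^ 2 =
        N ^ 2 * fixRatioProd (fun p => Block q (ℓ p)) ((fun _ => π) * σ⁻¹) ^ 2 := by
    intro π
    rw [← permTensor_const (fun p => Block q (ℓ p)) π, inner_permTensor, Complex.norm_real,
      Real.norm_eq_abs, sq_abs, mul_pow]
  simp only [hin] at hb
  rw [← Finset.mul_sum] at hb
  have hs := sum_fixRatioProd_sq_le (fun p => Block q (ℓ p)) σ hpp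
  have hs1 := sum_fixRatio_block_prod_le hx hx1 p
  have hs2 := sum_fixRatio_block_prod_le hx hx1 p'
  have hs3 : ∑ π : Perm (Fin K), fixRatioProd (fun p => Block q (ℓ p)) ((fun _ => π) * σ⁻¹) ^ 2 ≤
      2 * x := by linarith
  have hs4 := mul_le_mul_of_nonneg_left hs3 (sq_nonneg N)
  refine le_of_mul_le_mul_left (a := N) ?_ hNpos
  linarith

theorem norm_permTensor_sq {ι : Fin P → Type} [∀ p, Fintype (ι p)] [∀ p, DecidableEq (ι p)]
    [∀ p, Nonempty (ι p)] (σ : Fin P → Perm (Fin K)) :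
    ‖permTensor ι σ‖ ^ 2 = ∏ p, (Fintype.card (ι p) : ℝ) ^ K := by
  have h := inner_permTensor ι σ σ
  rw [mul_inv_cancel, fixRatioProd_one, mul_one, inner_self_eq_norm_sq_to_K] at h
  exact Complex.ofReal_injective ((Complex.ofReal_pow _ _).trans h)

theorem crosstwirl_permOp (h : ∀ p, ℓ p ≤ m p) (π : Perm (Fin K)) :
    crosstwirl K q h (permOp (Blocks q m) π) = permOp (Blocks q m) π :=
  crosstwirl_eq_self h fun _ => permOp_commute_tensorPower _ _

/-- The crosstwirl is small on the operators fixed by the block twirl and killed by the full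
twirl. -/
theorem norm_crosstwirl_sq_le [NeZero q] (hℓm : ∀ p, ℓ p ≤ m p) (hKL : K ≤ q ^ ∑ p, ℓ p)
    (h3 : ∀ p, 3 * ℓ p ≤ m p) (hx : (K : ℝ) ^ 2 * ∑ p, 1 / (q : ℝ) ^ (2 * ℓ p) = x)
    (hx1 : x ≤ 1 / 25) (c : (Fin P → Perm (Fin K)) → ℂ)
    (hR : fullTwirl K q m (∑ σ, c σ • permTensor (fun p => Block q (m p)) σ) = 0) :
    ‖crosstwirl K q hℓm (∑ σ, c σ • permTensor (fun p => Block q (m p)) σ)‖ ^ 2 ≤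
      25 * x * ‖∑ σ, c σ • permTensor (fun p => Block q (m p)) σ‖ ^ 2 := by
  have hx0 : 0 ≤ x := by rw [← hx]; positivity
  have hx1' : x ≤ 1 := by linarith
  let v := fun σ : Fin P → Perm (Fin K) => permTensor (fun p => Block q (m p)) σ
  let w := fun σ : Fin P → Perm (Fin K) => permTensor (fun p => Block q (ℓ p)) σ
  set N : ℝ := ∏ p, (Fintype.card (Block q (m p)) : ℝ) ^ K with hN
  set N₁ : ℝ := ∏ p, (Fintype.card (Block q (ℓ p)) : ℝ) ^ K with hN₁
  set N₂ : ℝ := ∏ p, (Fintype.card (Block q (m p - ℓ p)) : ℝ) ^ K with hN₂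
  have hpos : ∀ n : Fin P → ℕ, 0 < ∏ p, (Fintype.card (Block q (n p)) : ℝ) ^ K := fun n =>
    Finset.prod_pos fun p _ => by
      have : 0 < Fintype.card (Block q (n p)) := Fintype.card_pos
      positivity
  have hNpos : 0 < N := hpos m
  have hN₁pos : 0 < N₁ := hpos ℓ
  have hN₂pos : 0 < N₂ := hpos _
  have hNN : N = N₁ * N₂ := by
    rw [hN, hN₁, hN₂, ← Finset.prod_mul_distrib]
    refine Finset.prod_congr rfl fun p _ => ?_
    rw [← mul_pow, ← Nat.cast_mul, ← Fintype.card_prod,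
      Fintype.card_congr (splitBlock q (hℓm p))]
  have hcard : K ≤ Fintype.card (Blocks q ℓ) := by
    simpa [Finset.prod_pow_eq_pow_sum] using hKL
  have hlow := le_norm_sq_sum_smul (fun σ => fixRatioProd_nonneg (fun p => Block q (m p)) σ)
    (fixRatioProd_one _) (sum_fixRatioProd_block_le (fun p => by have := h3 p; omega) hx hx1')
    hNpos.le v (fun σ τ => inner_permTensor _ σ τ) c
  have hinner : ∀ σ τ, inner ℂ (v σ) (crosstwirl K q hℓm (v τ)) =
      inner ℂ (w σ) (twirl K (Blocks q ℓ) (w τ)) * ((N₂ * fixRatioProd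
        (fun p => Block q (m p - ℓ p)) (σ * τ⁻¹) : ℝ) : ℂ) := by
    intro σ τ
    rw [inner_crosstwirl_permTensor, inner_permTensor]
  -- The kernel β is that of the remaining m p - ℓ p ≥ 2ℓ p qudits, and t is N times the bound for
  -- ‖T w_σ‖²/N₁ at non-constant σ.
  have hup := norm_sq_proj_sum_le (t := N * (2 * x / (1 - x)))
    (fun σ => fixRatioProd_nonneg (fun p => Block q (m p - ℓ p)) σ)
    (fixRatioProd_one _) (sum_fixRatioProd_block_le (fun p => by have := h3 p; omega) hx hx1')
    hNpos.le (mul_nonneg hNpos.le (div_nonneg (by linarith) (by linarith))) v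
    (crosstwirl_isSymmetric K hℓm) (crosstwirl_idem hℓm) (fun σ => ∃ π, σ = fun _ => π)
    (by
      rintro _ ⟨π, rfl⟩
      simp only [v, permTensor_const]
      exact crosstwirl_permOp hℓm π)
    (by
      intro σ hσ
      rw [hinner, mul_inv_cancel, fixRatioProd_one, mul_one,
        ← norm_sq_eq_re_inner_of_isSymmetric (twirl_isSymmetric K (Blocks q ℓ))
          (twirl_idem hcard), norm_mul, Complex.norm_real, Complex.norm_real, Real.norm_eq_abs,
        Real.norm_eq_abs, abs_of_nonneg (by positivity), abs_of_pos hN₂pos, hNN]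
      have h := norm_sq_twirl_permTensor_le hKL hx hx1' σ hσ
      have h' : ‖twirl K (Blocks q ℓ) (w σ)‖ ^ 2 ≤ N₁ * (2 * x / (1 - x)) := by
        rw [← mul_div_assoc, le_div_iff₀ (by linarith), mul_comm]
        exact h
      calc _ ≤ N₁ * (2 * x / (1 - x)) * N₂ := mul_le_mul_of_nonneg_right h' hN₂pos.le
        _ = _ := by ring)
    (by
      intro σ τ _
      rw [hinner, norm_mul, Complex.norm_real, Real.norm_eq_abs,
        abs_of_nonneg (mul_nonneg hN₂pos.le (fixRatioProd_nonneg _ _)), hNN, mul_assoc]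
      refine mul_le_mul_of_nonneg_right ?_ (mul_nonneg hN₂pos.le (fixRatioProd_nonneg _ _))
      -- The twirl is a contraction and all w σ have squared norm N₁, so the first factor is at most
      -- N₁.
      have hw : ∀ σ, ‖w σ‖ ^ 2 = N₁ := fun σ => norm_permTensor_sq σ
      have hw' : ‖w σ‖ = ‖w τ‖ := by
        rw [← abs_of_nonneg (norm_nonneg (w σ)), ← abs_of_nonneg (norm_nonneg (w τ)),
          ← sq_eq_sq_iff_abs_eq_abs, hw, hw]
      calc _ ≤ ‖w σ‖ * ‖twirl K (Blocks q ℓ) (w τ)‖ := norm_inner_le_norm _ _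
        _ ≤ ‖w σ‖ * ‖w τ‖ := mul_le_mul_of_nonneg_left
            (norm_apply_le_of_isSymmetric (twirl_isSymmetric K _) (twirl_idem hcard) _)
            (norm_nonneg _)
        _ = N₁ := by rw [← hw', ← sq, hw])
    c
    (by
      rintro _ ⟨π, rfl⟩
      have hfix : fullTwirl K q m (v fun _ => π) = v fun _ => π := by
        simp only [v, permTensor_const]
        exact twirl_permOp K _ π
      -- A constant family is fixed by the symmetric full twirl, which kills X; hence their inner
      -- product is zero.
      rw [← hfix]
      refine (twirl_isSymmetric K (Blocks q m) _ _).trans ?_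
      exact (congrArg _ hR).trans (inner_zero_right _))
  set S : ℝ := ∑ σ, ‖c σ‖ ^ 2
  set Y : ℝ := ‖∑ σ, c σ • permTensor (fun p => Block q (m p)) σ‖ ^ 2
  have hS : 0 ≤ S := by positivity
  have hNS : N * S ≤ 25 / 24 * Y := by
    have : N * (24 / 25) * S ≤ N * (1 - x) * S := by
      refine mul_le_mul_of_nonneg_right (mul_le_mul_of_nonneg_left ?_ hNpos.le) hS
      linarith
    have h2 : N * (1 - x) * S ≤ Y := hlow
    linarith
  have hdiv : 2 * x / (1 - x) ≤ 3 * x := by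
    rw [div_le_iff₀ (by linarith)]
    nlinarith
  have hNS0 : 0 ≤ N * S := mul_nonneg hNpos.le hS
  have hY : 0 ≤ Y := by positivity
  -- For x ≤ 1/25 the constant obtained is 4 · 25/24, well below 25.
  calc _ ≤ (N * x + N * (2 * x / (1 - x))) * S := hup
    _ = (x + 2 * x / (1 - x)) * (N * S) := by ring
    _ ≤ (4 * x) * (N * S) := mul_le_mul_of_nonneg_right (by linarith) hNS0
    _ ≤ (4 * x) * (25 / 24 * Y) := mul_le_mul_of_nonneg_left hNS (by linarith)
    _ ≤ 25 * x * Y := by nlinarith [mul_nonneg hx0 hY]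

theorem norm_blockTwirl_crosstwirl_sub_le [NeZero q] (hP : 1 ≤ P) (hℓm : ∀ p, ℓ p ≤ m p)
    (hKm : ∀ p, K ≤ q ^ m p) (hKL : K ≤ q ^ ∑ p, ℓ p) (h3 : ∀ p, 3 * ℓ p ≤ m p)
    (Y : Matrix (Fin K → Blocks q m) (Fin K → Blocks q m) ℂ) :
    ‖blockTwirl K q m (crosstwirl K q hℓm Y) - fullTwirl K q m Y‖ ≤
      5 * (K : ℝ) * Real.sqrt (∑ p, 1 / (q : ℝ) ^ (2 * ℓ p)) * ‖Y‖ := by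
  set s : ℝ := ∑ p, 1 / (q : ℝ) ^ (2 * ℓ p) with hs
  have hs0 : 0 ≤ s := by positivity
  have hcard : ∀ p, K ≤ Fintype.card (Block q (m p)) := fun p => by simpa using hKm p
  have hcardA : K ≤ Fintype.card (Blocks q m) := by
    refine (hcard ⟨0, hP⟩).trans ?_
    exact Fintype.card_le_of_surjective (fun i : Blocks q m => i ⟨0, hP⟩)
      (Function.surjective_eval _)
  have hfix : ∀ σ : Fin P → Perm (Fin K),
      blockTwirl K q m (permTensor (fun p => Block q (m p)) σ) =
        permTensor (fun p => Block q (m p)) σ :=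
    tensorMap_permTensor _ fun p σ => twirl_permOp K _ σ
  have hrange := exists_tensorMap_eq_sum_permTensor
    (fun p => twirl K (Block q (m p))) fun p => exists_twirl_eq_sum_permOp K _ (hcard p)
  have hrangeR := exists_twirl_eq_sum_permOp K (Blocks q m) hcardA
  refine norm_comp_sub_le (P := blockTwirl K q m) (Q := crosstwirl K q hℓm)
    (R := fullTwirl K q m) (tensorMap_isSymmetric _ fun p => twirl_isSymmetric K _)
    (crosstwirl_isSymmetric K hℓm) (twirl_isSymmetric K _) (fun X => ?_)
    (twirl_idem hcardA) (fun X => ?_) (fun X => ?_) (by positivity) (fun X hPX hRX => ?_) Y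
  · obtain ⟨c, hc⟩ := hrange X
    change blockTwirl K q m X = _ at hc
    rw [hc, map_sum]
    simp only [map_smul, hfix]
  · obtain ⟨c, hc⟩ := hrangeR X
    change fullTwirl K q m X = _ at hc
    rw [hc, map_sum]
    refine Finset.sum_congr rfl fun π _ => ?_
    rw [map_smul, ← permTensor_const (fun p => Block q (m p)) π, hfix]
  · obtain ⟨c, hc⟩ := hrangeR X
    change fullTwirl K q m X = _ at hc
    rw [hc, map_sum]
    simp only [map_smul, crosstwirl_permOp]
  -- Beyond this threshold 5K√s is at least 1, and contractivity of the crosstwirl suffices.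
  · by_cases hsmall : (K : ℝ) ^ 2 * s ≤ 1 / 25
    · obtain ⟨c, hc⟩ := hrange X
      change blockTwirl K q m X = _ at hc
      rw [hPX] at hc
      subst hc
      have h := norm_crosstwirl_sq_le hℓm hKL h3 rfl hsmall c hRX
      refine le_of_sq_le_sq ?_ (by positivity)
      rw [mul_pow, mul_pow, mul_pow, Real.sq_sqrt hs0]
      refine h.trans (le_of_eq ?_)
      ring
    · have h := norm_apply_le_of_isSymmetric (crosstwirl_isSymmetric K hℓm)
        (crosstwirl_idem hℓm) X
      have h1 : (1 : ℝ) ≤ 5 * (K : ℝ) * Real.sqrt s := by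
        refine le_of_sq_le_sq ?_ (by positivity)
        rw [mul_pow, mul_pow, Real.sq_sqrt hs0]
        linarith
      exact h.trans (le_mul_of_one_le_left (norm_nonneg X) h1)

theorem norm22_le {J : Type} [Fintype J] {Φ : Matrix J J ℂ →ₗ[ℂ] Matrix J J ℂ} {η : ℝ}
    (hη : 0 ≤ η) (h : ∀ X, ‖Φ X‖ ≤ η * ‖X‖) : norm22 Φ ≤ η :=
  Real.iSup_le (fun X => (div_le_iff₀ (norm_pos_iff.mpr X.2)).mpr (h X)) hη

end Main

end Twirl

end

theorem mainTheorem4 (K q P : ℕ) (ℓ m : Fin P → ℕ)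
    (hK : 1 ≤ K) (hq : 1 ≤ q) (hP : 1 ≤ P)
    (hℓm : ∀ p, ℓ p ≤ m p)
    (hKm : ∀ p, K ≤ q ^ m p)
    (hKL : K ≤ q ^ ∑ p, ℓ p)
    (hK2L : K ^ 2 < 2 * q ^ ∑ p, ℓ p)
    (hsum : (K : ℝ) ^ 2 * ∑ p, 1 / (q : ℝ) ^ ℓ p ≤ 1)
    (h3 : ∀ p, 3 * ℓ p ≤ m p) :
    Twirl.norm22 (Twirl.blockTwirl K q m ∘ₗ Twirl.crosstwirl K q hℓm - Twirl.fullTwirl K q m) ≤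
      5 * (K : ℝ) * Real.sqrt (∑ p, 1 / (q : ℝ) ^ (2 * ℓ p)) := by
  have : NeZero q := ⟨by omega⟩
  exact Twirl.norm22_le (by positivity)
    (Twirl.norm_blockTwirl_crosstwirl_sub_le hP hℓm hKm hKL h3)
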